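/- For natural numbers $1\le m\le n$ consider the $m\times n$ grid: its nodes are the pairs $(i,j)$ (row $i$, column $j$) with $1\le i\le m$, $1\le j\le n$, and the distance of two nodes is the Euclidean distance. A tour is a cyclic order that visits every node exactly once (closed by the edge from the last node to the first); an optimal tour is one whose shortest edge is as long as possible. A tour is an $\alpha$-approximation if its shortest edge is at least $\alpha$ times the shortest edge of every tour. Put $k=\lfloor n/2\rfloor$ and $t=\lfloor m/2\rfloor$. The algorithm $\mathrm{Weave}(m,n)$ starts in row $1$ and column $c(1)$ (which is $k+2$ for $n\ge 3$), and moves from $(i,j)$ to $(r(i,j),c(j))$ until $r$ says TERMINATE. The successor column $c(j)$. For $n$ odd: $j+k+1$ if $j\le k$, and $j-k$ if $j>k$. For $n$ even and $k$ even: $j+k+1$ if $j\le k$ is odd, $j+k-1$ if $j\le k$ is even, $j-k$ if $j\in\{k+1,n\}$, and for $k+1<j<n$: $j-(k+1)$ if $j$ is odd, $j-(k-1)$ if $j$ is even. For $n$ even and $k$ odd: $j+k+1$ if $j<k$ is odd, $j+k-1$ if $j<k$ is even, $2k$ if $j=k$, $1$ if $j=k+1$, and for $j>k+1$: $j-(k+1)$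 if $j$ is even, $j-(k-1)$ if $j$ is odd. The successor row $r(i,j)$. - $m=1$: $1$ if $j\ne1$, TERMINATE if $j=1$. - $m$ even, $j\neq 1$: $i+t$ if $i\le t$, $i-t$ if $i>t$. $m$ even, $j=1$, $n$ odd: $i+t$ if $i\le t$, $i-(t-1)$ if $t<i<m$, TERMINATE if $i=m$. $m$ even, $j=1$, $n$ even: $i+t+1$ if $i<t$, TERMINATE if $i=t$, $i-(t-1)$ if $i>t$. - $m\ge3$ odd, $j\ne1$: $i+t$ if $i\le t+1$, $i-t$ if $t+1<i<m$, $1$ if $i=m$. - $m\ge 3$ odd, $j=1$, $i\in\{1,t+1,m\}$: if $3\nmid n$, then $1\mapsto t+1\mapsto m\mapsto 2$; if $3\mid n$, then $1\mapsto m\mapsto t+1\mapsto 2$; for $m=3$ the last step (the one to $2$) is replaced by TERMINATE. - $m\ge5$ odd, $j=1$, other $i$: for $n$ odd, $i+t$ if $i\le t$, $i-(t-1)$ if $t+1<i<m-1$, TERMINATE if $i=m-1$; for $n$ even, $i+t+1$ if $i<t$, TERMINATE if $i=t$, $i-(t-1)$ if $t+1<i<m-1$, $i-(t-2)$ if $i=m-1$.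 **Theorem.** $\mathrm{Weave}(m,n)$ is a linear-time algorithm: there are one program (unit-cost registers with addition, truncated subtraction, comparisons, loops and output of nodes) and one constant $C$ such that for all $1\le m\le n$ the program, on input $(m,n)$, outputs the sequence of nodes visited by $\mathrm{Weave}(m,n)$ and halts within $C\cdot mn$ steps, all numbers that it handles being at most $C\cdot mn$. This sequence is a tour of the $m\times n$ grid, and the tour is (i) optimal whenever $n$ is odd, $m=n$, or $m=2$; (ii) a $\sqrt{1-\frac{2(k-t)}{(k-t)^2+2t(k-1)+1}}$-approximation whenever $m$ and $n$ are even; (iii) a $\sqrt{1-\frac{2k-1}{k^2+t^2}}$-approximation whenever $n$ is even and $m$ is odd. -/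

import Mathlib

namespace ScatterTSP

/-! Nodes of the `m × n` grid are pairs `(row, column)` with `1 ≤ row ≤ m`, `1 ≤ column ≤ n`. -/

/-- The position in the Euclidean plane of the node in row `p.1` and column `p.2`. -/
noncomputable def position (p : ℕ × ℕ) : EuclideanSpace ℝ (Fin 2) :=
  !₂[(p.2 : ℝ), (p.1 : ℝ)]

/-- A tour of the complete graph on the nodes of the `m × n` grid, as the list of the nodes in
the order in which they are visited: every grid node exactly once and nothing else.  The tour
returns from the last node of the list to the first one. -/
def IsTour (m n : ℕ) (L : List (ℕ × ℕ)) : Prop :=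
  L.Nodup ∧ ∀ p : ℕ × ℕ, p ∈ L ↔ (1 ≤ p.1 ∧ p.1 ≤ m) ∧ (1 ≤ p.2 ∧ p.2 ≤ n)

/-- The edges of a closed tour: all pairs of consecutive nodes, the closing pair included. -/
def tourEdges (L : List (ℕ × ℕ)) : List ((ℕ × ℕ) × (ℕ × ℕ)) :=
  L.zip (L.rotate 1)

/-- The Euclidean length of the shortest edge of a closed tour (an infimum over the finite set of
edge lengths, which is nonempty as soon as the tour has a node). -/
noncomputable def shortestEdge (L : List (ℕ × ℕ)) : ℝ :=
  sInf {d : ℝ | ∃ e ∈ tourEdges L, d = dist (position e.1) (position e.2)}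

/-- The tour `L` is optimal: its shortest edge is as long as possible. -/
def IsOptimal (m n : ℕ) (L : List (ℕ × ℕ)) : Prop :=
  IsTour m n L ∧ ∀ T : List (ℕ × ℕ), IsTour m n T → shortestEdge T ≤ shortestEdge L

/-- The tour `L` is within the factor `α` of every tour. -/
def IsApprox (α : ℝ) (m n : ℕ) (L : List (ℕ × ℕ)) : Prop :=
  IsTour m n L ∧ ∀ T : List (ℕ × ℕ), IsTour m n T → α * shortestEdge T ≤ shortestEdge L

/-! ### The algorithm `Weave` -/

/-- The successor column of column `j`, where `k = n / 2`. -/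
def nextCol (n j : ℕ) : ℕ :=
  let k := n / 2
  if n % 2 = 1 then
    if j ≤ k then j + k + 1 else j - k
  else if k % 2 = 0 then
    if j ≤ k then
      if j % 2 = 1 then j + k + 1 else j + k - 1
    else if j = k + 1 ∨ j = n then j - k
    else if j % 2 = 1 then j - (k + 1) else j - (k - 1)
  else
    if j < k then
      if j % 2 = 1 then j + k + 1 else j + k - 1
    else if j = k then j + k
    else if j = k + 1 then j - k
    else if j % 2 = 0 then j - (k + 1) else j - (k - 1)

/-- Successor row for `m` even, where `t = m / 2`; `none` means that the algorithm terminates. -/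
def nextRowEven (m n i j : ℕ) : Option ℕ :=
  let t := m / 2
  if n % 2 = 1 then
    if i ≤ t then some (i + t)
    else if j ≠ 1 then some (i - t)
    else if i < m then some (i - (t - 1))
    else none
  else
    if j ≠ 1 then
      if i ≤ t then some (i + t) else some (i - t)
    else if i < t then some (i + (t + 1))
    else if i = t then none
    else some (i - (t - 1))

/-- Successor row for `m = 3`: the triple of rows is traversed, then the algorithm terminates. -/
def nextRowThree (n i j : ℕ) : Option ℕ :=
  if j ≠ 1 then
    if i = 3 then some 1 else some (i + 1)
  else if n % 3 ≠ 0 then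
    if i = 3 then none else some (i + 1)
  else
    if i = 1 then some 3
    else if i = 3 then some 2
    else none

/-- Successor row for `m ≥ 5` odd and `n` not divisible by three, where `t = m / 2`. -/
def nextRowOdd (m n i j : ℕ) : Option ℕ :=
  let t := m / 2
  if n % 2 = 1 then
    if i ≤ t + 1 then some (i + t)
    else if j ≠ 1 then
      if i < m then some (i - t) else some 1
    else if i < m - 1 then some (i - (t - 1))
    else if i = m - 1 then none
    else some 2
  else
    if j ≠ 1 then
      if i ≤ t + 1 then some (i + t)
      else if i < m then some (i - t) else some 1
    else if i = 1 ∨ i = t + 1 then some (i + t)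
    else if i < t then some (i + (t + 1))
    else if i = t then none
    else if i < m - 1 then some (i - (t - 1))
    else if i = m - 1 then some (i - (t - 2))
    else some 2

/-- Successor row for `m ≥ 5` odd and `n` divisible by three, where `t = m / 2`. -/
def nextRowOddThree (m n i j : ℕ) : Option ℕ :=
  let t := m / 2
  if j ≠ 1 then
    if i ≤ t + 1 then some (i + t)
    else if i < m then some (i - t) else some 1
  else if i = 1 then some m
  else if i = m then some (t + 1)
  else if n % 2 = 1 then
    if i ≤ t then some (i + t)
    else if i < m - 1 then some (i - (t - 1))
    else none
  else
    if i < t then some (i + (t + 1))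
    else if i = t then none
    else if i < m - 1 then some (i - (t - 1))
    else some (i - (t - 2))

/-- The successor row of the node `(i, j)`; `none` means that the algorithm terminates.  For
`m = 1` the single row is traversed once. -/
def nextRow (m n i j : ℕ) : Option ℕ :=
  if m = 1 then (if j = 1 then none else some 1)
  else if m % 2 = 0 then nextRowEven m n i j
  else if m = 3 then nextRowThree n i j
  else if n % 3 ≠ 0 then nextRowOdd m n i j
  else nextRowOddThree m n i j

/-- `WeaveFrom m n i j L`: started in the node `(i, j)`, the algorithm terminates and visits the
nodes of `L`, in this order. -/
inductive WeaveFrom (m n : ℕ) : ℕ → ℕ → List (ℕ × ℕ) → Prop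
  | last {i j : ℕ} : nextRow m n i j = none → WeaveFrom m n i j [(i, j)]
  | step {i j i' : ℕ} {L : List (ℕ × ℕ)} : nextRow m n i j = some i' →
      WeaveFrom m n i' (nextCol n j) L → WeaveFrom m n i j ((i, j) :: L)

/-- `L` is the list of nodes specified by `Weave(m, n)`.  The starting column is the successor of
column `1`; this is `n / 2 + 2` whenever `n ≥ 3`. -/
def IsWeave (m n : ℕ) (L : List (ℕ × ℕ)) : Prop :=
  WeaveFrom m n 1 (nextCol n 1) L

/-! ### Programs with a step count

Programs over finitely many registers that hold natural numbers bounded by a word bound `B`; the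
only arithmetic is addition and truncated subtraction.  Every operation costs one step. -/

/-- Arithmetic expressions over the registers. -/
inductive AExp
  | const (c : ℕ)
  | reg (x : ℕ)
  | add (a b : AExp)
  | sub (a b : AExp)

/-- The value of an expression. -/
def AExp.eval (s : ℕ → ℕ) : AExp → ℕ
  | .const c => c
  | .reg x => s x
  | .add a b => a.eval s + b.eval s
  | .sub a b => a.eval s - b.eval s

/-- The number of steps for the evaluation of an expression. -/
def AExp.cost : AExp → ℕ
  | .const _ => 1
  | .reg _ => 1
  | .add a b => a.cost + b.cost + 1
  | .sub a b => a.cost + b.cost + 1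

/-- All values that appear in the evaluation of an expression respect the word bound. -/
def AExp.Fits (B : ℕ) (s : ℕ → ℕ) : AExp → Prop
  | .const c => c ≤ B
  | .reg x => s x ≤ B
  | .add a b => a.Fits B s ∧ b.Fits B s ∧ a.eval s + b.eval s ≤ B
  | .sub a b => a.Fits B s ∧ b.Fits B s

/-- Tests. -/
inductive BExp
  | le (a b : AExp)
  | eq (a b : AExp)
  | and (p q : BExp)
  | not (p : BExp)

/-- The truth value of a test. -/
def BExp.Holds (s : ℕ → ℕ) : BExp → Prop
  | .le a b => a.eval s ≤ b.eval s
  | .eq a b => a.eval s = b.eval s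
  | .and p q => p.Holds s ∧ q.Holds s
  | .not p => ¬ p.Holds s

/-- The number of steps for a test. -/
def BExp.cost : BExp → ℕ
  | .le a b => a.cost + b.cost + 1
  | .eq a b => a.cost + b.cost + 1
  | .and p q => p.cost + q.cost + 1
  | .not p => p.cost + 1

/-- All values that appear in a test respect the word bound. -/
def BExp.Fits (B : ℕ) (s : ℕ → ℕ) : BExp → Prop
  | .le a b => a.Fits B s ∧ b.Fits B s
  | .eq a b => a.Fits B s ∧ b.Fits B s
  | .and p q => p.Fits B s ∧ q.Fits B s
  | .not p => p.Fits B s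

/-- Programs: assignments, output of a node, sequences, case distinctions and loops. -/
inductive Prog
  | skip
  | assign (x : ℕ) (a : AExp)
  | emit (a b : AExp)
  | seq (c d : Prog)
  | cond (p : BExp) (c d : Prog)
  | loop (p : BExp) (c : Prog)

/-- `Exec B c s s' L T`: with word bound `B`, the program `c`, started with register contents `s`,
halts after exactly `T` steps with register contents `s'`, and meanwhile outputs the list `L` of
nodes. -/
inductive Exec (B : ℕ) : Prog → (ℕ → ℕ) → (ℕ → ℕ) → List (ℕ × ℕ) → ℕ → Prop
  | skip {s : ℕ → ℕ} : Exec B .skip s s [] 1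
  | assign {s : ℕ → ℕ} {x : ℕ} {a : AExp} : a.Fits B s →
      Exec B (.assign x a) s (Function.update s x (a.eval s)) [] (a.cost + 1)
  | emit {s : ℕ → ℕ} {a b : AExp} : a.Fits B s → b.Fits B s →
      Exec B (.emit a b) s s [(a.eval s, b.eval s)] (a.cost + b.cost + 1)
  | seq {s s' s'' : ℕ → ℕ} {c d : Prog} {L M : List (ℕ × ℕ)} {T U : ℕ} :
      Exec B c s s' L T → Exec B d s' s'' M U → Exec B (.seq c d) s s'' (L ++ M) (T + U)
  | condTrue {s s' : ℕ → ℕ} {p : BExp} {c d : Prog} {L : List (ℕ × ℕ)} {T : ℕ} :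
      p.Fits B s → p.Holds s → Exec B c s s' L T →
      Exec B (.cond p c d) s s' L (p.cost + 1 + T)
  | condFalse {s s' : ℕ → ℕ} {p : BExp} {c d : Prog} {L : List (ℕ × ℕ)} {T : ℕ} :
      p.Fits B s → ¬ p.Holds s → Exec B d s s' L T →
      Exec B (.cond p c d) s s' L (p.cost + 1 + T)
  | loopDone {s : ℕ → ℕ} {p : BExp} {c : Prog} :
      p.Fits B s → ¬ p.Holds s → Exec B (.loop p c) s s [] (p.cost + 1)
  | loopStep {s s' s'' : ℕ → ℕ} {p : BExp} {c : Prog} {L M : List (ℕ × ℕ)} {T U : ℕ} :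
      p.Fits B s → p.Holds s → Exec B c s s' L T → Exec B (.loop p c) s' s'' M U →
      Exec B (.loop p c) s s'' (L ++ M) (p.cost + 1 + T + U)

/-- The initial register contents: the input `m`, `n` in registers `0` and `1`, and `0` else. -/
def inputRegs (m n : ℕ) : ℕ → ℕ
  | 0 => m
  | 1 => n
  | _ => 0

/-- On input `(m, n)` the program `P` halts within `N` steps with output `L`, and all numbers that
it handles are at most `N`. -/
def OutputsWithin (P : Prog) (m n N : ℕ) (L : List (ℕ × ℕ)) : Prop :=
  ∃ (s : ℕ → ℕ) (T : ℕ), T ≤ N ∧ Exec N P (inputRegs m n) s L T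

end ScatterTSP

open ScatterTSP

namespace ScatterTSP

/-! Write `k = n / 2` and `t = m / 2`. The shortest edge of every tour is bounded from above, every
edge of the closed `Weave` tour from below, and a program imitates `Weave` at constant cost per
node.

Upper bounds. All nodes lie within `√(k² + t²)` of a central node. If `m` and `n` are even, only one
corner is that far from `(t, k)`; of the two distinct neighbours of `(t, k)` on a tour, one is not
this corner and lies within `√(k² + (t - 1)²)`. For `m = 2` and even `n ≥ 4`, edges all longer than
`√((k - 1)² + 1)` would join both nodes of column `k` to both nodes of column `2k`, closing a
4-cycle inside a longer tour.

Tour. The column map is a single `n`-cycle (`nextCol_colAt`, `colAt_injOn`), so the walk splits into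
passes through all columns, each ending in column 1. Before its last step a pass moves the row by
one injective map, `rowShift`. It is an involution, except for the 3-cycle `1, t + 1, m` when `m ≥
3` is odd. The row at the end of a pass is therefore governed by the parity of `n`, or by `n % 3` on
the 3-cycle, and the rule in column 1 is tuned so that the `m` passes start in distinct rows
(`nextRow_iterate_rowStart`, `rowStart_injOn`).

Lower bound. An edge from outside column 1 spans at least `(n - 1) / 2` columns and `t` rows. An
edge from column 1 may lose up to two rows, but spans `k + 1` columns if `n ≥ 3`, which compensates
because `t ≤ k`. So `√(((n - 1) / 2)² + t²)` is a lower bound (`IsWeave.le_shortestEdge`). It meets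
the upper bounds in the optimal cases; otherwise the quotient of the two is the stated factor.

Running time. One move is a loop-free program (`exists_exec_run`); only the preliminary divisions by
2 and 3 need loops, of length `O(n)`. -/

/-! ### Upper bounds for the shortest edge of an arbitrary tour -/

theorem dist_position (p q : ℕ × ℕ) :
    dist (position p) (position q) =
      √(((p.2 : ℝ) - q.2) ^ 2 + ((p.1 : ℝ) - q.1) ^ 2) := by
  rw [EuclideanSpace.dist_eq]
  simp [position, Fin.sum_univ_two, Real.dist_eq, sq_abs]

theorem shortestEdge_le {L : List (ℕ × ℕ)} {e : (ℕ × ℕ) × (ℕ × ℕ)} (he : e ∈ tourEdges L) :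
    shortestEdge L ≤ dist (position e.1) (position e.2) :=
  csInf_le ⟨0, by rintro d ⟨e, -, rfl⟩; exact dist_nonneg⟩ ⟨e, he, rfl⟩

theorem le_shortestEdge {L : List (ℕ × ℕ)} {d : ℝ} (hL : L ≠ [])
    (h : ∀ e ∈ tourEdges L, d ≤ dist (position e.1) (position e.2)) : d ≤ shortestEdge L := by
  refine le_csInf ?_ ?_
  · have : tourEdges L ≠ [] := by
      intro h0
      have := congrArg List.length h0
      simp [tourEdges] at this
      exact hL this
    obtain ⟨e, he⟩ := List.exists_mem_of_ne_nil _ this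
    exact ⟨_, e, he, rfl⟩
  · rintro _ ⟨e, he, rfl⟩
    exact h e he

theorem IsTour.length_eq {m n : ℕ} {L : List (ℕ × ℕ)} (h : IsTour m n L) : L.length = m * n := by
  have : L.toFinset = Finset.Icc 1 m ×ˢ Finset.Icc 1 n := by
    ext p
    rw [List.mem_toFinset, h.2]
    simp
  rw [← List.toFinset_card_of_nodup h.1, this]
  simp

/-- A tour as a periodic enumeration of the nodes of the grid. -/
theorem IsTour.exists_enumeration {m n : ℕ} {L : List (ℕ × ℕ)} (hm : 1 ≤ m) (hn : 1 ≤ n)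
    (h : IsTour m n L) :
    ∃ g : ℕ → ℕ × ℕ, (∀ s s', g s = g s' ↔ s ≡ s' [MOD m * n]) ∧
      (∀ s, (1 ≤ (g s).1 ∧ (g s).1 ≤ m) ∧ 1 ≤ (g s).2 ∧ (g s).2 ≤ n) ∧
      (∀ i j, 1 ≤ i → i ≤ m → 1 ≤ j → j ≤ n → ∃ s, g s = (i, j)) ∧
      ∀ s, shortestEdge L ≤ dist (position (g s)) (position (g (s + 1))) := by
  have hlen := h.length_eq
  have hpos : 0 < L.length := by rw [hlen]; exact Nat.mul_pos hm hn
  refine ⟨fun s => L[s % L.length]'(Nat.mod_lt _ hpos), ?_, ?_, ?_, ?_⟩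
  · intro s s'
    rw [h.1.getElem_inj_iff, hlen]
    rfl
  · intro s
    exact (h.2 _).1 (List.getElem_mem _)
  · intro i j h1 h2 h3 h4
    obtain ⟨s, hs, he⟩ := List.mem_iff_getElem.1 ((h.2 (i, j)).2 ⟨⟨h1, h2⟩, h3, h4⟩)
    exact ⟨s, by simpa [Nat.mod_eq_of_lt hs] using he⟩
  · intro s
    have hs := Nat.mod_lt s hpos
    refine shortestEdge_le (e := (_, _)) ?_
    have : (tourEdges L)[s % L.length]'(by simpa [tourEdges] using hs) =
        (L[s % L.length]'(Nat.mod_lt _ hpos), L[(s + 1) % L.length]'(Nat.mod_lt _ hpos)) := by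
      simp [tourEdges, List.getElem_rotate]
    rw [← this]
    exact List.getElem_mem _

theorem sq_sub_le_sq_of_le {a b c : ℕ} (h1 : a ≤ b + c) (h2 : b ≤ a + c) :
    ((a : ℝ) - b) ^ 2 ≤ (c : ℝ) ^ 2 := by
  have h1' : (a : ℝ) ≤ b + c := by exact_mod_cast h1
  have h2' : (b : ℝ) ≤ a + c := by exact_mod_cast h2
  exact sq_le_sq' (by linarith) (by linarith)

theorem dist_position_le {p q : ℕ × ℕ} {a b : ℕ} (h1 : p.2 ≤ q.2 + a) (h2 : q.2 ≤ p.2 + a)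
    (h3 : p.1 ≤ q.1 + b) (h4 : q.1 ≤ p.1 + b) :
    dist (position p) (position q) ≤ √((a : ℝ) ^ 2 + (b : ℝ) ^ 2) := by
  rw [dist_position]
  exact Real.sqrt_le_sqrt (add_le_add (sq_sub_le_sq_of_le h1 h2) (sq_sub_le_sq_of_le h3 h4))

/-- A node in the middle of the grid has distance at most `√(k² + t²)` from all nodes. -/
theorem IsTour.shortestEdge_le {m n : ℕ} {L : List (ℕ × ℕ)} (hm : 1 ≤ m) (hn : 1 ≤ n)
    (h : IsTour m n L) :
    shortestEdge L ≤ √(((n / 2 : ℕ) : ℝ) ^ 2 + ((m / 2 : ℕ) : ℝ) ^ 2) := by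
  obtain ⟨g, -, hg, hs, he⟩ := h.exists_enumeration hm hn
  obtain ⟨s, hs⟩ := hs ((m + 1) / 2) ((n + 1) / 2) (by omega) (by omega) (by omega) (by omega)
  refine (he s).trans ?_
  have := hg (s + 1)
  rw [hs]
  apply dist_position_le <;> simp only <;> omega

/-- The predecessor is reached by going `N - 1` steps forward on the periodic enumeration. It
differs from the successor because `N ≥ 3` does not divide 2. -/
theorem exists_two_neighbours {N : ℕ} {g : ℕ → ℕ × ℕ} {d : ℝ} (hN : 3 ≤ N)
    (hg : ∀ s s', g s = g s' ↔ s ≡ s' [MOD N])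
    (he : ∀ s, d ≤ dist (position (g s)) (position (g (s + 1)))) {v : ℕ × ℕ}
    (hv : ∃ s, g s = v) :
    ∃ s, g (s + 1) = v ∧ g s ≠ g (s + 2) ∧ d ≤ dist (position v) (position (g s)) ∧
      d ≤ dist (position v) (position (g (s + 2))) := by
  obtain ⟨s, rfl⟩ := hv
  have e : g (s + (N - 1) + 1) = g s := by
    rw [hg, add_assoc, Nat.sub_add_cancel (by omega)]
    simp [Nat.ModEq]
  refine ⟨s + (N - 1), e, ?_, ?_, ?_⟩
  · rw [Ne, hg]
    intro h
    have : 0 ≡ 2 [MOD N] := Nat.ModEq.add_left_cancel' _ h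
    rw [Nat.ModEq, Nat.zero_mod, Nat.mod_eq_of_lt (by omega)] at this
    omega
  · rw [dist_comm, ← e]
    exact he _
  · rw [← e]
    exact he _

theorem IsTour.shortestEdge_le_of_even {m n : ℕ} {L : List (ℕ × ℕ)} (hm : 1 ≤ m) (hmn : m ≤ n)
    (hme : Even m) (hne : Even n) (h : IsTour m n L) :
    shortestEdge L ≤ √(((n / 2 : ℕ) : ℝ) ^ 2 + (((m / 2 : ℕ) : ℝ) - 1) ^ 2) := by
  obtain ⟨t, rfl⟩ := hme
  obtain ⟨k, rfl⟩ := hne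
  obtain ⟨g, hmod, hg, hsurj, he⟩ := h.exists_enumeration hm (by omega)
  obtain ⟨s, hs, hne, h1, h2⟩ := exists_two_neighbours
    (le_trans (by norm_num) (Nat.mul_le_mul (by omega : 2 ≤ t + t) (by omega : 2 ≤ k + k))) hmod he
    (hsurj t k (by omega) (by omega) (by omega) (by omega))
  have key : ∀ q : ℕ × ℕ, (1 ≤ q.1 ∧ q.1 ≤ t + t) ∧ 1 ≤ q.2 ∧ q.2 ≤ k + k →
      q ≠ (t + t, k + k) → dist (position (t, k)) (position q) ≤
        √((((k + k) / 2 : ℕ) : ℝ) ^ 2 + ((((t + t) / 2 : ℕ) : ℝ) - 1) ^ 2) := by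
    intro q hq hne
    rw [show (k + k) / 2 = k by omega, show (t + t) / 2 = t by omega]
    have hcast : ((t - 1 : ℕ) : ℝ) = (t : ℝ) - 1 := by
      rw [Nat.cast_sub (by omega)]; simp
    rcases Nat.lt_or_ge q.1 (t + t) with h | h
    · rw [← hcast]
      apply dist_position_le <;> simp only <;> omega
    -- In the last row the corner is excluded, so a column is lost instead of a row. The bound `(k -
    -- 1)² + t² ≤ k² + (t - 1)²` is where `t ≤ k` enters.
    · have h2 : q.2 < k + k := by
        by_contra h2
        exact hne (Prod.ext (by simp only; omega) (by simp only; omega))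
      have h3 : dist (position (t, k)) (position q) ≤ √(((k - 1 : ℕ) : ℝ) ^ 2 + (t : ℝ) ^ 2) := by
        apply dist_position_le <;> simp only <;> omega
      refine h3.trans (Real.sqrt_le_sqrt ?_)
      rw [Nat.cast_sub (by omega)]
      have : (t : ℝ) ≤ k := by exact_mod_cast (by omega : t ≤ k)
      push_cast
      nlinarith
  by_cases hc : g s = (t + t, k + k)
  · exact h2.trans (key _ (hg _) (fun h' => hne (hc.trans h'.symm)))
  · exact h1.trans (key _ (hg _) hc)

theorem IsTour.shortestEdge_le_of_two {n : ℕ} {L : List (ℕ × ℕ)} (hn : 1 ≤ n)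
    (hne : Even n) (h : IsTour 2 n L) :
    shortestEdge L ≤ √((((n / 2 : ℕ) : ℝ) - 1) ^ 2 + 1 ^ 2) := by
  rcases eq_or_ne n 2 with rfl | hn2
  · refine (h.shortestEdge_le_of_even (by norm_num) le_rfl even_two even_two).trans_eq ?_
    norm_num
  obtain ⟨k, rfl⟩ := hne
  obtain ⟨g, hmod, hg, hsurj, he⟩ := h.exists_enumeration (by norm_num) hn
  rw [show (k + k) / 2 = k by omega]
  by_contra! hlt
  -- Only column `2k` is `k` columns away from column `k`; all others are at most `k - 1` away.
  have key : ∀ i, (i = 1 ∨ i = 2) → ∀ q : ℕ × ℕ, (1 ≤ q.1 ∧ q.1 ≤ 2) ∧ 1 ≤ q.2 ∧ q.2 ≤ k + k →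
      shortestEdge L ≤ dist (position (i, k)) (position q) → q = (1, k + k) ∨ q = (2, k + k) := by
    intro i hi q hq hd
    have h2 : q.2 = k + k := by
      by_contra h2
      have h3 : dist (position (i, k)) (position q) ≤ √(((k - 1 : ℕ) : ℝ) ^ 2 + ((1 : ℕ) : ℝ) ^ 2) := by
        apply dist_position_le <;> simp only <;> omega
      rw [Nat.cast_sub (by omega)] at h3
      push_cast at h3
      linarith
    have h1 : q.1 = 1 ∨ q.1 = 2 := by omega
    rcases h1 with h1 | h1
    · exact .inl (Prod.ext h1 h2)
    · exact .inr (Prod.ext h1 h2)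
  obtain ⟨a, ha, hane, ha1, ha2⟩ := exists_two_neighbours (by omega) hmod he
    (hsurj 1 k (by omega) (by omega) (by omega) (by omega))
  obtain ⟨b, hb, hbne, hb1, hb2⟩ := exists_two_neighbours (by omega) hmod he
    (hsurj 2 k (by omega) (by omega) (by omega) (by omega))
  have a1 := key 1 (.inl rfl) _ (hg _) ha1
  have a2 := key 1 (.inl rfl) _ (hg _) ha2
  have b1 := key 2 (.inr rfl) _ (hg _) hb1
  have b2 := key 2 (.inr rfl) _ (hg _) hb2
  have hab : g a ≠ g b := by
    intro hab
    have : g (a + 1) = g (b + 1) := (hmod _ _).2 (((hmod _ _).1 hab).add_right 1)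
    rw [ha, hb] at this
    simp at this
  have third : ∀ {x y p q r : ℕ × ℕ}, (p = x ∨ p = y) → (q = x ∨ q = y) → (r = x ∨ r = y) →
      p ≠ q → p ≠ r → q = r := by
    rintro x y p q r (rfl | rfl) (rfl | rfl) (rfl | rfl) h1 h2 <;>
      first | rfl | exact absurd rfl h1 | exact absurd rfl h2
  -- The predecessors of the two nodes of column `k` differ, so each node is followed by the
  -- predecessor of the other. The walk is back after four steps, whereas its period is `4k ≥ 8`.
  have e1 : g (a + 2) = g b := third a1 a2 b1 hane hab
  have e2 : g (b + 2) = g a := third b1 b2 a1 hbne hab.symm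
  have m1 := ((hmod _ _).1 e1).add_right 2
  have m2 := m1.trans ((hmod _ _).1 e2)
  have : 4 ≡ 0 [MOD 2 * (k + k)] := Nat.ModEq.add_left_cancel' a m2
  have h4 := Nat.le_of_dvd (by norm_num) ((Nat.modEq_zero_iff_dvd).1 this)
  omega

/-! ### The cycle of columns -/

/-- The `q`-th iterate of `nextCol n` at column `1`, for `q < n`. -/
def colAt (n q : ℕ) : ℕ :=
  if n % 2 = 1 then
    if q % 2 = 0 then q / 2 + 1 else q / 2 + n / 2 + 2
  else if q < n / 2 then
    if q % 2 = 0 then q + 1 else q + n / 2 + 1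
  else if q % 2 = 0 then n - q else n + n / 2 - q

theorem colAt_zero {n : ℕ} (hn : 1 ≤ n) : colAt n 0 = 1 := by
  unfold colAt; split_ifs <;> omega

theorem colAt_mem {n q : ℕ} (hq : q < n) : 1 ≤ colAt n q ∧ colAt n q ≤ n := by
  unfold colAt; split_ifs <;> omega

/-- The branches of the formula have disjoint ranges: for odd `n` they are separated by the two
halves of the columns; for even `n` each half is swept upwards in one parity class and downwards in
the other. -/
theorem colAt_injOn {n p q : ℕ} (hp : p < n) (hq : q < n) (h : colAt n p = colAt n q) :
    p = q := by
  unfold colAt at h; split_ifs at h <;> omega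

theorem nextCol_colAt {n q : ℕ} (hq : q < n) :
    nextCol n (colAt n q) = colAt n ((q + 1) % n) := by
  rcases Nat.lt_or_ge (q + 1) n with h | h
  · rw [Nat.mod_eq_of_lt h]
    unfold nextCol colAt
    rcases Nat.mod_two_eq_zero_or_one n with hn | hn <;>
    rcases Nat.mod_two_eq_zero_or_one (n / 2) with hk | hk <;>
    rcases Nat.mod_two_eq_zero_or_one q with hq2 | hq2 <;>
    have hq3 : (q + 1) % 2 = 1 - q % 2 := by omega
    all_goals
      simp only [hn, hk, hq2, hq3]
      simp only [zero_ne_one, one_ne_zero, if_true, if_false, Nat.sub_zero]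
      split_ifs <;> omega
  -- The cycle closes: its last column is `n / 2 + 1`, whose successor is column 1.
  · obtain rfl : n = q + 1 := by omega
    have hc : colAt (q + 1) q = (q + 1) / 2 + 1 := by unfold colAt; split_ifs <;> omega
    rw [Nat.mod_self, colAt_zero (by omega), hc]
    generalize hj : (q + 1) / 2 + 1 = j
    simp only [nextCol]
    split_ifs <;> omega

/-! ### The rows during a pass and at its end -/

/-- The successor row of a node outside column `1`. -/
def rowShift (m i : ℕ) : ℕ :=
  if m = 1 then 1
  else if m % 2 = 0 then
    if i ≤ m / 2 then i + m / 2 else i - m / 2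
  else if i ≤ m / 2 + 1 then i + m / 2
  else if i < m then i - m / 2 else 1

/-- All dependence on `n` in the row rule is confined to column 1. -/
theorem nextRow_of_ne_one {m n i j : ℕ} (him : i ≤ m) (hj : j ≠ 1) :
    nextRow m n i j = some (rowShift m i) := by
  unfold nextRow rowShift nextRowEven nextRowThree nextRowOdd nextRowOddThree
  simp only [hj, if_false, ne_eq, not_false_eq_true, if_true]
  split_ifs <;> simp only [Option.some.injEq] <;> omega

theorem rowShift_mapsTo (m : ℕ) : Set.MapsTo (rowShift m) (Set.Icc 1 m) (Set.Icc 1 m) := by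
  intro i hi
  simp only [Set.mem_Icc] at hi ⊢
  unfold rowShift; split_ifs <;> omega

theorem rowShift_injOn (m : ℕ) : Set.InjOn (rowShift m) (Set.Icc 1 m) := by
  intro i hi j hj h
  simp only [Set.mem_Icc] at hi hj
  unfold rowShift at h; split_ifs at h <;> omega

theorem rowShift_rowShift {m i : ℕ} (hi : 1 ≤ i) (him : i ≤ m)
    (h : m % 2 = 0 ∨ (i ≠ 1 ∧ i ≠ m / 2 + 1 ∧ i ≠ m)) : rowShift m (rowShift m i) = i := by
  -- Unfolding through an equation keeps `rowShift m i` an atom in the outer application.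
  have e : ∀ a, rowShift m a = if m = 1 then 1
      else if m % 2 = 0 then
        if a ≤ m / 2 then a + m / 2 else a - m / 2
      else if a ≤ m / 2 + 1 then a + m / 2
      else if a < m then a - m / 2 else 1 := fun _ => rfl
  have e1 := e i
  have e2 := e (rowShift m i)
  split_ifs at e1 <;> split_ifs at e2 <;> omega

/-- The iterate of the row shift over a whole pass through the columns, up to the last one. -/
theorem rowShift_iterate_of_involutive {m n i : ℕ} (hn : 1 ≤ n) (hi : 1 ≤ i) (him : i ≤ m)
    (h : m % 2 = 0 ∨ (i ≠ 1 ∧ i ≠ m / 2 + 1 ∧ i ≠ m)) :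
    (rowShift m)^[n - 1] i = if n % 2 = 1 then i else rowShift m i := by
  have hp : Function.IsPeriodicPt (rowShift m) 2 i := rowShift_rowShift hi him h
  rw [← hp.iterate_mod_apply]
  split_ifs with h2
  · have : (n - 1) % 2 = 0 := by omega
    rw [this]; rfl
  · have : (n - 1) % 2 = 1 := by omega
    rw [this]; rfl

/-- These rows are permuted cyclically, `1 ↦ m / 2 + 1 ↦ m ↦ 1`, so only `n - 1` modulo 3 matters.
For `m = 1` they coincide. -/
theorem rowShift_iterate_of_three_cycle {m n i : ℕ} (hm : m % 2 = 1) (hn : 1 ≤ n)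
    (h : i = 1 ∨ i = m / 2 + 1 ∨ i = m) :
    (rowShift m)^[n - 1] i =
      if n % 3 = 1 then i else if n % 3 = 2 then rowShift m i else rowShift m (rowShift m i) := by
  have h1 : rowShift m 1 = m / 2 + 1 := by unfold rowShift; split_ifs <;> omega
  have h2 : rowShift m (m / 2 + 1) = m := by unfold rowShift; split_ifs <;> omega
  have h3 : rowShift m m = 1 := by unfold rowShift; split_ifs <;> omega
  have hp : Function.IsPeriodicPt (rowShift m) 3 i := by
    change rowShift m (rowShift m (rowShift m i)) = i
    rcases h with rfl | h | h
    · rw [h1, h2, h3]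
    · rw [h, h2, h3, h1]
    · rw [h, h3, h1, h2]
  rw [← hp.iterate_mod_apply]
  split_ifs with h4 h5
  · have : (n - 1) % 3 = 0 := by omega
    rw [this]; rfl
  · have : (n - 1) % 3 = 1 := by omega
    rw [this]; rfl
  · have : (n - 1) % 3 = 2 := by omega
    rw [this]; rfl

/-- The row in which `Weave` starts its `p`-th pass through the columns. -/
def rowStart (m n p : ℕ) : ℕ :=
  if m % 2 = 0 then
    if n % 2 = 1 then
      if p % 2 = 0 then p / 2 + 1 else p / 2 + 1 + m / 2
    else p + 1
  else if p = 0 then 1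
  else if p = 1 then if n % 3 = 2 then m else m / 2 + 1
  else if p = 2 then if n % 3 = 2 then m / 2 + 1 else m
  else if n % 2 = 1 then
    if p % 2 = 1 then p / 2 + 1 else p / 2 + m / 2
  else if p < m / 2 + 2 then p - 1 else p

theorem rowStart_zero (m n : ℕ) : rowStart m n 0 = 1 := by
  unfold rowStart; split_ifs <;> omega

theorem rowStart_mem {m n p : ℕ} (hp : p < m) : 1 ≤ rowStart m n p ∧ rowStart m n p ≤ m := by
  unfold rowStart; split_ifs <;> omega

theorem rowStart_injOn {m n p q : ℕ} (hp : p < m) (hq : q < m)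
    (h : rowStart m n p = rowStart m n q) : p = q := by
  unfold rowStart at h
  split_ifs at h <;> omega

/-- Divisibility of `n` by three affects only the rows of the 3-cycle; elsewhere the two rules for
odd `m ≥ 5` agree. -/
theorem nextRow_one_of_odd {m n i : ℕ} (hm : m % 2 = 1) (hm5 : 5 ≤ m)
    (hi : i ≠ 1 ∧ i ≠ m / 2 + 1 ∧ i ≠ m) (him : i ≤ m) :
    nextRow m n i 1 =
      if n % 2 = 1 then
        if i ≤ m / 2 then some (i + m / 2)
        else if i < m - 1 then some (i - (m / 2 - 1)) else none
      else if i < m / 2 then some (i + (m / 2 + 1))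
      else if i = m / 2 then none
      else if i < m - 1 then some (i - (m / 2 - 1)) else some (i - (m / 2 - 2)) := by
  have hm0 : m % 2 ≠ 0 := by omega
  have hm1 : m ≠ 1 := by omega
  have hm3 : m ≠ 3 := by omega
  obtain ⟨h1, h2, h3⟩ := hi
  have h4 : i ≤ m / 2 + 1 ↔ i ≤ m / 2 := by omega
  simp only [nextRow, hm0, hm1, hm3, if_false]
  split_ifs with h3n
  all_goals
    first
    | (simp only [nextRowOdd, *, if_true, if_false, ne_eq, not_true_eq_false, or_self]; try rfl)
    | (simp only [nextRowOddThree, *, if_true, if_false, ne_eq, not_true_eq_false]; try rfl)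
  all_goals
    try simp only [nextRowOddThree]
    split_ifs <;> first | rfl | (exfalso; omega)

theorem nextRow_one_of_three_cycle {m : ℕ} (n : ℕ) (hm : m % 2 = 1) (hm3 : 3 ≤ m) :
    (nextRow m n 1 1 = if n % 3 = 0 then some m else some (m / 2 + 1)) ∧
    (nextRow m n (m / 2 + 1) 1 = if n % 3 = 0 then (if m = 3 then none else some 2) else some m) ∧
    nextRow m n m 1 = if n % 3 = 0 then some (m / 2 + 1) else
      if m = 3 then none else some 2 := by
  rcases eq_or_ne m 3 with rfl | h3
  · refine ⟨?_, ?_, ?_⟩ <;> by_cases hn : n % 3 = 0 <;> simp [nextRow, nextRowThree, hn]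
  have h0 : m % 2 ≠ 0 := by omega
  have h1 : m ≠ 1 := by omega
  have h2 : ¬ m / 2 + 1 ≤ m / 2 := by omega
  have h5 : ¬ m ≤ m / 2 + 1 := by omega
  have h6 : ¬ m < m - 1 := by omega
  have h7 : ¬ m = m - 1 := by omega
  have h8 : ¬ m / 2 + 1 = m := by omega
  have h9 : m / 2 + 1 < m - 1 := by omega
  have h10 : m / 2 + 1 - (m / 2 - 1) = 2 := by omega
  have h11 : ¬ m < m / 2 := by omega
  have h12 : ¬ m = m / 2 := by omega
  have h13 : m / 2 + 1 + m / 2 = m := by omega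
  have h14 : ¬ m = m / 2 + 1 := by omega
  have h15 : ¬ m / 2 + 1 < m / 2 := by omega
  refine ⟨?_, ?_, ?_⟩ <;> by_cases hn : n % 3 = 0 <;>
    rcases Nat.mod_two_eq_zero_or_one n with hn2 | hn2 <;>
    simp [nextRow, nextRowOdd, nextRowOddThree, hn, hn2, h0, h1, h2, h3, h5, h6, h7, h8, h9,
      h10, h11, h12, h13, h14, h15] <;> omega

/-- The rule in column 1 undoes the net effect of a pass and moves on to the next starting row. For
odd `m ≥ 3` the first three passes use the rows of the 3-cycle, and the later ones never meet them.
-/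
theorem nextRow_iterate_rowStart {m n p : ℕ} (hn : 1 ≤ n) (hp : p < m) :
    nextRow m n ((rowShift m)^[n - 1] (rowStart m n p)) 1 =
      if p + 1 < m then some (rowStart m n (p + 1)) else none := by
  have hmem := rowStart_mem (n := n) hp
  rcases Nat.mod_two_eq_zero_or_one m with hm | hm
  · rw [rowShift_iterate_of_involutive hn hmem.1 hmem.2 (.inl hm)]
    have hm1 : m ≠ 1 := by omega
    simp only [nextRow, nextRowEven, rowShift, rowStart, hm, hm1, if_true, if_false, ne_eq,
      not_true_eq_false]
    split_ifs <;> first | rfl | (exfalso; omega) | (simp only [Option.some.injEq]; omega)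
  · rcases Nat.lt_or_ge p 3 with h3 | h3
    · have htr : rowStart m n p = 1 ∨ rowStart m n p = m / 2 + 1 ∨ rowStart m n p = m := by
        simp only [rowStart, hm, one_ne_zero, if_false]
        split_ifs <;> omega
      rw [rowShift_iterate_of_three_cycle hm hn htr]
      have h1 : rowShift m 1 = m / 2 + 1 := by unfold rowShift; split_ifs <;> omega
      have h2 : rowShift m (m / 2 + 1) = m := by unfold rowShift; split_ifs <;> omega
      have h3' : rowShift m m = 1 := by unfold rowShift; split_ifs <;> omega
      have hn3 : n % 3 = 0 ∨ n % 3 = 1 ∨ n % 3 = 2 := by omega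
      have hs0 := rowStart_zero m n
      have hs1 : rowStart m n 1 = if n % 3 = 2 then m else m / 2 + 1 := by
        simp [rowStart, hm]
      have hs2 : rowStart m n 2 = if n % 3 = 2 then m / 2 + 1 else m := by
        simp [rowStart, hm]
      rcases eq_or_ne m 1 with rfl | hm1
      · obtain rfl : p = 0 := by omega
        simp [nextRow]
      have hs3 : 3 < m → rowStart m n 3 = 2 := by
        intro h
        have h' : 3 < m / 2 + 2 := by omega
        simp [rowStart, hm, h']
      obtain ⟨n1, n2, n3⟩ := nextRow_one_of_three_cycle n hm (by omega)
      have hm0 : 2 < m := by omega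
      have hm0' : 1 < m := by omega
      have hm0'' : (3 < m) ↔ ¬ m = 3 := by omega
      interval_cases p <;> rcases hn3 with h | h | h <;>
        simp only [hs0, hs1, hs2, h, h1, h2, h3', n1, n2, n3, one_ne_zero, if_false, if_true,
          Nat.reduceAdd, zero_ne_one, OfNat.ofNat_ne_zero, OfNat.zero_ne_ofNat,
          hm0, hm0', hm0'', OfNat.one_ne_ofNat, OfNat.ofNat_ne_one] <;>
        split_ifs <;> first | rfl | rw [hs3 (by omega)]
    · have hne : rowStart m n p ≠ 1 ∧ rowStart m n p ≠ m / 2 + 1 ∧ rowStart m n p ≠ m := by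
        simp only [rowStart, hm, one_ne_zero, if_false]
        split_ifs <;> omega
      rw [rowShift_iterate_of_involutive hn hmem.1 hmem.2 (.inr hne)]
      have hshift : rowShift m (rowStart m n p) = if rowStart m n p ≤ m / 2 then
          rowStart m n p + m / 2 else rowStart m n p - m / 2 := by
        unfold rowShift; split_ifs <;> omega
      have hs : ∀ q, 3 ≤ q → rowStart m n q = if n % 2 = 1 then
          if q % 2 = 1 then q / 2 + 1 else q / 2 + m / 2
          else if q < m / 2 + 2 then q - 1 else q := by
        intro q hq
        unfold rowStart
        rw [if_neg (by omega), if_neg (by omega), if_neg (by omega), if_neg (by omega)]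
      have hsp := hs p h3
      rw [hs (p + 1) (by omega)]
      have hr1 : 1 ≤ rowShift m (rowStart m n p) ∧ rowShift m (rowStart m n p) ≤ m :=
        rowShift_mapsTo m hmem
      -- For even `n` the pass ends in the shifted row, so this row must also be off the 3-cycle.
      have hr2 : rowShift m (rowStart m n p) ≠ 1 ∧ rowShift m (rowStart m n p) ≠ m / 2 + 1 ∧
          rowShift m (rowStart m n p) ≠ m := by
        split_ifs at hshift <;> omega
      generalize rowShift m (rowStart m n p) = b at *
      generalize rowStart m n p = a at *
      rcases Nat.mod_two_eq_zero_or_one n with hn2 | hn2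
      · simp only [hn2, zero_ne_one, if_false] at hsp ⊢
        rw [nextRow_one_of_odd hm (by omega) hr2 hr1.2, if_neg (by omega)]
        split_ifs at hsp hshift ⊢ <;> first | rfl | (exfalso; omega) | (simp only [Option.some.injEq]; omega)
      · simp only [hn2, if_true] at hsp ⊢
        rw [nextRow_one_of_odd hm (by omega) hne hmem.2, if_pos hn2]
        split_ifs at hsp ⊢ <;> first | rfl | (exfalso; omega) | (simp only [Option.some.injEq]; omega)

/-! ### The visited nodes form a tour -/

/-- The node that `Weave` visits after `s` steps. -/
def weaveNode (m n s : ℕ) : ℕ × ℕ :=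
  ((rowShift m)^[s % n] (rowStart m n (s / n)), colAt n ((s % n + 1) % n))

theorem weaveNode_mem {m n s : ℕ} (hs : s < m * n) :
    weaveNode m n s ∈ Finset.Icc 1 m ×ˢ Finset.Icc 1 n := by
  have hn : 0 < n := Nat.pos_of_ne_zero (by rintro rfl; simp at hs)
  have h1 : s / n < m := Nat.div_lt_of_lt_mul (by rwa [mul_comm])
  have h2 := (rowShift_mapsTo m).iterate (s % n) (rowStart_mem (n := n) h1)
  have h3 := colAt_mem (Nat.mod_lt (s % n + 1) hn)
  simp only [weaveNode, Finset.mem_product, Finset.mem_Icc]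
  exact ⟨h2, h3⟩

/-- The column determines the position `s % n` within the pass. Equal rows at equal positions come
from equal starting rows, since `rowShift` is injective on the grid rows, and the starting row
determines the pass `s / n`. -/
theorem weaveNode_injOn (m n : ℕ) : Set.InjOn (weaveNode m n) (Set.Iio (m * n)) := by
  intro s hs s' hs' h
  simp only [Set.mem_Iio] at hs hs'
  have hn : 0 < n := Nat.pos_of_ne_zero (by rintro rfl; simp at hs)
  have h1 : s / n < m := Nat.div_lt_of_lt_mul (by rwa [mul_comm])
  have h1' : s' / n < m := Nat.div_lt_of_lt_mul (by rwa [mul_comm])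
  have hr : s % n < n := Nat.mod_lt _ hn
  have hr' : s' % n < n := Nat.mod_lt _ hn
  simp only [weaveNode, Prod.mk.injEq] at h
  have hc := colAt_injOn (Nat.mod_lt _ hn) (Nat.mod_lt _ hn) h.2
  have hmod : s % n = s' % n := by
    have : s % n ≡ s' % n [MOD n] := Nat.ModEq.add_right_cancel' 1 hc
    rwa [Nat.ModEq, Nat.mod_mod, Nat.mod_mod] at this
  have hq := h.1
  rw [hmod] at hq
  have := (rowShift_injOn m).iterate (rowShift_mapsTo m) (s' % n)
    (rowStart_mem (n := n) h1) (rowStart_mem (n := n) h1') hq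
  have hd := rowStart_injOn h1 h1' this
  rw [← Nat.div_add_mod s n, ← Nat.div_add_mod s' n, hd, hmod]

theorem weaveNode_snd_succ {m n s : ℕ} (hn : 1 ≤ n) :
    (weaveNode m n (s + 1)).2 = nextCol n (weaveNode m n s).2 := by
  simp only [weaveNode]
  rw [nextCol_colAt (Nat.mod_lt _ hn)]
  congr 1
  simp [Nat.add_mod]

theorem nextRow_weaveNode {m n s : ℕ} (hs : s < m * n) :
    nextRow m n (weaveNode m n s).1 (weaveNode m n s).2 =
      if s + 1 < m * n then some (weaveNode m n (s + 1)).1 else none := by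
  have hn : 0 < n := Nat.pos_of_ne_zero (by rintro rfl; simp at hs)
  have h1 : s / n < m := Nat.div_lt_of_lt_mul (by rwa [mul_comm])
  have hr : s % n < n := Nat.mod_lt _ hn
  have hsn := Nat.div_add_mod s n
  rcases Nat.lt_or_ge (s % n + 1) n with h | h
  -- Inside a pass: the column is not 1, and the row moves by `rowShift`.
  · have hd : (s + 1) / n = s / n := by
      rw [← hsn, add_assoc, Nat.mul_add_div hn, Nat.mul_add_div hn, Nat.div_eq_of_lt h,
        Nat.div_eq_of_lt hr]
    have hm : (s + 1) % n = s % n + 1 := by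
      conv_lhs => rw [← hsn, add_assoc, Nat.mul_add_mod, Nat.mod_eq_of_lt h]
    have hlt : s + 1 < m * n := by nlinarith
    have hmem := weaveNode_mem hs
    simp only [Finset.mem_product, Finset.mem_Icc] at hmem
    rw [if_pos hlt, nextRow_of_ne_one hmem.1.2]
    · simp [weaveNode, hd, hm, Function.iterate_succ_apply']
    · simp only [weaveNode]
      intro h0
      have := colAt_injOn (Nat.mod_lt _ hn) hn (h0.trans (colAt_zero hn).symm)
      rw [Nat.mod_eq_of_lt h] at this
      omega
  -- End of a pass: the column is 1, and the next pass begins unless this was the last one.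
  · have h' : s % n = n - 1 := by omega
    have hsn' : s + 1 = n * (s / n + 1) := by rw [mul_add]; omega
    have hd : (s + 1) / n = s / n + 1 := by rw [hsn', Nat.mul_div_cancel_left _ hn]
    have hm : (s + 1) % n = 0 := by rw [hsn', Nat.mul_mod_right]
    have hcol : (weaveNode m n s).2 = 1 := by
      simp only [weaveNode, h']
      rw [Nat.sub_add_cancel hn, Nat.mod_self, colAt_zero hn]
    have hiff : s + 1 < m * n ↔ s / n + 1 < m := by
      rw [hsn', mul_comm m n]; exact Nat.mul_lt_mul_left hn
    rw [hcol]
    simp only [weaveNode, h', hd, hm, hiff, Function.iterate_zero, id]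
    exact nextRow_iterate_rowStart hn h1

/-- The list of the nodes visited by `Weave`. -/
def weaveList (m n : ℕ) : List (ℕ × ℕ) := (List.range (m * n)).map (weaveNode m n)

theorem weaveFrom_weaveNode {m n : ℕ} (hn : 1 ≤ n) (d s : ℕ) (h : s + d + 1 = m * n) :
    WeaveFrom m n (weaveNode m n s).1 (weaveNode m n s).2
      ((List.range' s (d + 1)).map (weaveNode m n)) := by
  induction d generalizing s with
  | zero =>
    refine .last ?_
    rw [nextRow_weaveNode (by omega), if_neg (by omega)]
  | succ d ih =>
    have h1 := nextRow_weaveNode (m := m) (n := n) (s := s) (by omega)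
    rw [if_pos (by omega)] at h1
    rw [List.range'_succ, List.map_cons]
    refine .step h1 ?_
    rw [← weaveNode_snd_succ hn]
    exact ih (s + 1) (by omega)

theorem isWeave_weaveList {m n : ℕ} (hm : 1 ≤ m) (hn : 1 ≤ n) : IsWeave m n (weaveList m n) := by
  have hp : 0 < m * n := Nat.mul_pos hm hn
  have h := weaveFrom_weaveNode (m := m) hn (m * n - 1) 0 (by omega)
  have h0 : weaveNode m n 0 = (1, nextCol n 1) := by
    have := nextCol_colAt (n := n) (q := 0) hn
    rw [colAt_zero hn] at this
    simp [weaveNode, rowStart_zero, this]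
  rw [h0, Nat.sub_add_cancel hp, ← List.range_eq_range'] at h
  exact h

theorem isTour_weaveList (m n : ℕ) : IsTour m n (weaveList m n) := by
  have hnd : (weaveList m n).Nodup := by
    refine List.Nodup.map_on ?_ List.nodup_range
    intro s hs s' hs' h
    exact weaveNode_injOn m n (by simpa using hs) (by simpa using hs') h
  refine ⟨hnd, ?_⟩
  have hsub : (weaveList m n).toFinset ⊆ Finset.Icc 1 m ×ˢ Finset.Icc 1 n := by
    intro p hp
    simp only [weaveList, List.mem_toFinset, List.mem_map, List.mem_range] at hp
    obtain ⟨s, hs, rfl⟩ := hp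
    exact weaveNode_mem hs
  -- Surjectivity comes from counting: `m * n` distinct nodes in a grid of `m * n` nodes.
  have heq := Finset.eq_of_subset_of_card_le hsub (by
    rw [List.toFinset_card_of_nodup hnd]; simp [weaveList])
  intro p
  rw [← List.mem_toFinset, heq]
  simp

/-! ### Lower bound for the edges of `Weave` -/

/-- The difference of two natural numbers is at least `d`, in absolute value. -/
def Apart (d a b : ℕ) : Prop := a + d ≤ b ∨ b + d ≤ a

theorem Apart.sq_le {d a b : ℕ} (h : Apart d a b) : (d : ℝ) ^ 2 ≤ ((a : ℝ) - b) ^ 2 := by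
  have hd : (0 : ℝ) ≤ d := Nat.cast_nonneg d
  rcases h with h | h
  · have h' : (a : ℝ) + d ≤ b := by exact_mod_cast h
    nlinarith
  · have h' : (b : ℝ) + d ≤ a := by exact_mod_cast h
    nlinarith

theorem le_dist_position {p q : ℕ × ℕ} {a b c d : ℕ} (h2 : Apart c p.2 q.2)
    (h1 : Apart d p.1 q.1) (h : a ^ 2 + b ^ 2 ≤ c ^ 2 + d ^ 2) :
    √((a : ℝ) ^ 2 + (b : ℝ) ^ 2) ≤ dist (position p) (position q) := by
  rw [dist_position]
  refine Real.sqrt_le_sqrt (le_trans ?_ (add_le_add h2.sq_le h1.sq_le))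
  exact_mod_cast h

theorem apart_nextCol {n j : ℕ} (hj : 1 ≤ j) (hjn : j ≤ n) :
    Apart ((n - 1) / 2) j (nextCol n j) := by
  simp only [nextCol, Apart]
  split_ifs <;> omega

theorem nextCol_one {n : ℕ} (hn : 1 ≤ n) : nextCol n 1 = if n = 1 then 1 else if n = 2 then 2 else n / 2 + 2 := by
  simp only [nextCol]
  split_ifs <;> omega

theorem apart_nextCol_one {n : ℕ} (hn : 1 ≤ n) :
    Apart (if n ≤ 2 then n - 1 else n / 2 + 1) 1 (nextCol n 1) := by
  rw [nextCol_one hn]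
  simp only [Apart]
  split_ifs <;> omega

theorem apart_rowShift (m i : ℕ) : Apart (m / 2) i (rowShift m i) := by
  unfold rowShift Apart
  split_ifs <;> omega

/-- The default row 1 on termination covers the closing edge, which returns to the starting row. The
subtraction is truncated, so nothing is claimed when `m / 2` is too small. -/
theorem apart_nextRow_one {m i : ℕ} (n : ℕ) (hi : 1 ≤ i) (him : i ≤ m) :
    Apart (m / 2 - if n % 2 = 1 then 1 else 2) i ((nextRow m n i 1).getD 1) := by
  rcases Nat.mod_two_eq_zero_or_one m with hm | hm
  · have hm1 : m ≠ 1 := by omega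
    simp only [nextRow, nextRowEven, hm, hm1, if_true, if_false, ne_eq, not_true_eq_false, Apart]
    split_ifs <;> simp only [Option.getD_some, Option.getD_none] <;> omega
  · rcases eq_or_ne m 1 with rfl | hm1
    · simp only [nextRow, Apart, if_true, Option.getD_none]
      omega
    by_cases h : i = 1 ∨ i = m / 2 + 1 ∨ i = m
    · obtain ⟨h1, h2, h3⟩ := nextRow_one_of_three_cycle n hm (by omega)
      rcases h with h | h | h
      · rw [h, h1]
        unfold Apart
        split_ifs <;> simp only [Option.getD_some] <;> omega
      · rw [h, h2]
        unfold Apart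
        split_ifs <;> simp only [Option.getD_some, Option.getD_none] <;> omega
      · rw [h, h3]
        unfold Apart
        split_ifs <;> simp only [Option.getD_some, Option.getD_none] <;> omega
    · rw [nextRow_one_of_odd hm (by omega) (by omega) him]
      unfold Apart
      split_ifs <;> simp only [Option.getD_some, Option.getD_none] <;> omega

/-- The node that follows `p` on the closed tour `Weave(m, n)`. -/
def nextNode (m n : ℕ) (p : ℕ × ℕ) : ℕ × ℕ := ((nextRow m n p.1 p.2).getD 1, nextCol n p.2)

theorem le_dist_nextNode {m n i j : ℕ} (hmn : m ≤ n) (hi : 1 ≤ i) (him : i ≤ m) (hj : 1 ≤ j)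
    (hjn : j ≤ n) :
    √((((n - 1) / 2 : ℕ) : ℝ) ^ 2 + ((m / 2 : ℕ) : ℝ) ^ 2) ≤
      dist (position (i, j)) (position (nextNode m n (i, j))) := by
  rcases eq_or_ne j 1 with rfl | hj1
  · refine le_dist_position (apart_nextCol_one hjn) (apart_nextRow_one n hi him) ?_
    -- The cases are `n = 1`, `n = 2`, odd `n ≥ 3` and even `n ≥ 4`. The last two amount to `k² + t²
    -- ≤ (k + 1)² + (t - 1)²` and `(k - 1)² + t² ≤ (k + 1)² + (t - 2)²`, with small `t` treated
    -- apart because of truncation.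
    split_ifs with h1 h2 h2
    · have h3 : m / 2 = 0 := by omega
      rw [h3, show n - 1 = 0 by omega]
    · have h3 : m / 2 ≤ 1 := by omega
      have h4 : n - 1 = 1 := by omega
      rw [h4]
      have : (m / 2) ^ 2 ≤ 1 := pow_le_one₀ (Nat.zero_le _) h3
      simp only [Nat.reduceDiv]
      omega
    · have h3 : (n - 1) / 2 = n / 2 := by omega
      rw [h3]
      have h4 : m / 2 ≤ n / 2 := by omega
      rcases Nat.eq_zero_or_pos (m / 2) with h5 | h5
      · rw [h5]; nlinarith
      · obtain ⟨u, hu⟩ := Nat.exists_eq_add_of_lt h5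
        rw [hu] at h4 ⊢
        rw [show 0 + u + 1 - 1 = u by omega]
        nlinarith
    · obtain ⟨v, hv⟩ : ∃ v, n / 2 = v + 1 := ⟨n / 2 - 1, by omega⟩
      have h3 : (n - 1) / 2 = v := by omega
      rw [h3, hv]
      have h4 : m / 2 ≤ v + 1 := by omega
      rcases Nat.lt_or_ge (m / 2) 2 with h5 | h5
      · have : (m / 2) ^ 2 ≤ 1 := pow_le_one₀ (Nat.zero_le _) (by omega)
        nlinarith
      · obtain ⟨u, hu⟩ := Nat.exists_eq_add_of_le h5
        rw [hu] at h4 ⊢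
        rw [show 2 + u - 2 = u by omega]
        nlinarith
  · refine le_dist_position (apart_nextCol hj hjn) (d := m / 2) ?_ le_rfl
    simp only [nextNode, nextRow_of_ne_one him hj1, Option.getD_some]
    exact apart_rowShift m i

theorem WeaveFrom.eq_cons {m n i j : ℕ} {L : List (ℕ × ℕ)} (h : WeaveFrom m n i j L) :
    ∃ L', L = (i, j) :: L' := by
  cases h <;> exact ⟨_, rfl⟩

/-- The appended node is the start of the tour, so the closing edge is included. It obeys the same
successor rule because termination happens only in column 1. -/
theorem WeaveFrom.zip_tail {m n i j : ℕ} {L : List (ℕ × ℕ)} (h : WeaveFrom m n i j L)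
    (hL : ∀ p ∈ L, p.1 ≤ m) :
    ∀ e ∈ L.zip (L.tail ++ [(1, nextCol n 1)]), e.2 = nextNode m n e.1 := by
  induction h with
  | @last i j h =>
    intro e he
    simp only [List.tail_cons, List.nil_append, List.zip_cons_cons, List.zip_nil_right,
      List.mem_singleton] at he
    subst he
    have hj : j = 1 := by
      by_contra hj
      rw [nextRow_of_ne_one (hL _ List.mem_cons_self) hj] at h
      cases h
    subst hj
    simp [nextNode, h]
  | @step i j i' L h hw ih =>
    intro e he
    obtain ⟨L', rfl⟩ := hw.eq_cons
    simp only [List.tail_cons, List.cons_append, List.zip_cons_cons, List.mem_cons] at he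
    rcases he with rfl | he
    · simp [nextNode, h]
    · exact ih (fun p hp => hL p (List.mem_cons_of_mem _ hp)) e (by simpa using he)

theorem IsWeave.le_shortestEdge {m n : ℕ} {L : List (ℕ × ℕ)} (hmn : m ≤ n) (h : IsWeave m n L)
    (hL : IsTour m n L) :
    √((((n - 1) / 2 : ℕ) : ℝ) ^ 2 + ((m / 2 : ℕ) : ℝ) ^ 2) ≤ shortestEdge L := by
  have hz := WeaveFrom.zip_tail h (fun p hp => ((hL.2 p).1 hp).1.2)
  obtain ⟨L', rfl⟩ := WeaveFrom.eq_cons h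
  refine ScatterTSP.le_shortestEdge (by simp) ?_
  rintro ⟨p, q⟩ he
  have hq : q = nextNode m n p := hz _ (by simpa [tourEdges] using he)
  have hp := (hL.2 p).1 (List.of_mem_zip he).1
  rw [hq]
  exact le_dist_nextNode hmn hp.1.1 hp.1.2 hp.2.1 hp.2.2

/-! ### Comparison of the bounds -/

theorem isOptimal_of_isWeave {m n : ℕ} {L : List (ℕ × ℕ)} (hm : 1 ≤ m) (hmn : m ≤ n)
    (h : IsWeave m n L) (hL : IsTour m n L) (hc : Odd n ∨ m = n ∨ m = 2) : IsOptimal m n L := by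
  refine ⟨hL, fun T hT => le_trans ?_ (h.le_shortestEdge hmn hL)⟩
  rcases Nat.even_or_odd n with hn | hn
  · have hn2 := Nat.even_iff.1 hn
    have hcast : (((n - 1) / 2 : ℕ) : ℝ) = ((n / 2 : ℕ) : ℝ) - 1 := by
      rw [show (n - 1) / 2 = n / 2 - 1 by omega, Nat.cast_sub (by omega)]
      simp
    rw [hcast]
    rcases hc with hc | rfl | rfl
    · exact absurd hn (Nat.not_even_iff_odd.2 hc)
    · refine (hT.shortestEdge_le_of_even hm le_rfl hn hn).trans_eq ?_
      rw [add_comm]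
    · simpa using hT.shortestEdge_le_of_two (by omega) hn
  · have hn2 := Nat.odd_iff.1 hn
    rw [show (n - 1) / 2 = n / 2 by omega]
    exact hT.shortestEdge_le hm (by omega)

theorem isApprox_of_sqrt {m n : ℕ} {L : List (ℕ × ℕ)} {a b : ℝ} (hL : IsTour m n L) (hb : 0 < b)
    (h1 : √(b - a) ≤ shortestEdge L) (h2 : ∀ T, IsTour m n T → shortestEdge T ≤ √b) :
    IsApprox (√(1 - a / b)) m n L := by
  refine ⟨hL, fun T hT => le_trans ?_ h1⟩
  refine (mul_le_mul_of_nonneg_left (h2 T hT) (Real.sqrt_nonneg _)).trans_eq ?_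
  rw [← Real.sqrt_mul' _ hb.le]
  congr 1
  field_simp

/-! ### Loop-free programs without output -/

/-- Programs that consist of assignments and case distinctions. -/
inductive Straight : Prog → Prop
  | assign (x : ℕ) (a : AExp) : Straight (.assign x a)
  | seq {c d : Prog} : Straight c → Straight d → Straight (.seq c d)
  | cond {p : BExp} {c d : Prog} : Straight c → Straight d → Straight (.cond p c d)

open Classical in
/-- The effect of a straight program on the registers. -/
noncomputable def run : Prog → (ℕ → ℕ) → (ℕ → ℕ)
  | .assign x a, s => Function.update s x (a.eval s)
  | .seq c d, s => run d (run c s)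
  | .cond p c d, s => if p.Holds s then run c s else run d s
  | _, s => s

/-- A bound for the number of steps of a straight program. -/
def maxCost : Prog → ℕ
  | .assign _ a => a.cost + 1
  | .seq c d => maxCost c + maxCost d
  | .cond p c d => p.cost + 1 + (maxCost c + maxCost d)
  | _ => 0

/-- If all registers are at most `M ≥ 1`, then all values in the evaluation of the expression are
at most `a.growth * M`. -/
def AExp.growth : AExp → ℕ
  | .const c => c
  | .reg _ => 1
  | .add a b => a.growth + b.growth
  | .sub a b => a.growth + b.growth

/-- If all registers are at most `M ≥ 1`, then all values in the test are at most
`p.growth * M`. -/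
def BExp.growth : BExp → ℕ
  | .le a b => a.growth + b.growth
  | .eq a b => a.growth + b.growth
  | .and p q => p.growth + q.growth
  | .not p => p.growth

/-- If all registers are at most `M ≥ 1`, then all values that a straight program handles are at
most `growth c * M`. -/
def growth : Prog → ℕ
  | .assign _ a => a.growth + 1
  | .seq c d => growth c * growth d
  | .cond p c d => p.growth + growth c + growth d
  | _ => 1

theorem AExp.eval_le {M : ℕ} {s : ℕ → ℕ} (hM : 1 ≤ M) (hs : ∀ x, s x ≤ M) (a : AExp) :
    a.eval s ≤ a.growth * M := by
  induction a with
  | const c => exact Nat.le_mul_of_pos_right c hM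
  | reg x => simpa [AExp.eval, AExp.growth] using hs x
  | add a b iha ihb => simp only [AExp.eval, AExp.growth, add_mul]; omega
  | sub a b iha ihb => simp only [AExp.eval, AExp.growth, add_mul]; omega

theorem AExp.fits {M B : ℕ} {s : ℕ → ℕ} (hM : 1 ≤ M) (hs : ∀ x, s x ≤ M) (a : AExp)
    (h : a.growth * M ≤ B) : a.Fits B s := by
  induction a with
  | const c => exact (Nat.le_mul_of_pos_right c hM).trans h
  | reg x =>
    simp only [AExp.growth, one_mul] at h
    exact (hs x).trans h
  | add a b iha ihb =>
    simp only [AExp.growth, add_mul] at h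
    have h1 := a.eval_le hM hs
    have h2 := b.eval_le hM hs
    exact ⟨iha (by omega), ihb (by omega), by omega⟩
  | sub a b iha ihb =>
    simp only [AExp.growth, add_mul] at h
    exact ⟨iha (by omega), ihb (by omega)⟩

theorem BExp.fits {M B : ℕ} {s : ℕ → ℕ} (hM : 1 ≤ M) (hs : ∀ x, s x ≤ M) (p : BExp)
    (h : p.growth * M ≤ B) : p.Fits B s := by
  induction p with
  | le a b =>
    simp only [BExp.growth, add_mul] at h
    exact ⟨a.fits hM hs (by omega), b.fits hM hs (by omega)⟩
  | eq a b =>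
    simp only [BExp.growth, add_mul] at h
    exact ⟨a.fits hM hs (by omega), b.fits hM hs (by omega)⟩
  | and p q ihp ihq =>
    simp only [BExp.growth, add_mul] at h
    exact ⟨ihp (by omega), ihq (by omega)⟩
  | not p ih => exact ih h

theorem one_le_growth {c : Prog} (hc : Straight c) : 1 ≤ growth c := by
  induction hc with
  | assign x a => simp [growth]
  | seq _ _ ihc ihd => exact Nat.mul_pos ihc ihd
  | cond _ _ ihc ihd => simp only [growth]; omega

theorem run_le {M : ℕ} {c : Prog} (hc : Straight c) {s : ℕ → ℕ} (hM : 1 ≤ M)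
    (hs : ∀ x, s x ≤ M) (y : ℕ) : run c s y ≤ growth c * M := by
  induction hc generalizing s M y with
  | assign x a =>
    have h1 := a.eval_le hM hs
    have h2 := hs y
    simp only [run, growth, Function.update_apply, add_mul]
    split_ifs <;> omega
  | @seq c d hc hd ihc ihd =>
    have h1 : 1 ≤ growth c * M := Nat.mul_pos (one_le_growth hc) hM
    refine (ihd h1 (ihc hM hs) y).trans_eq ?_
    simp only [growth]
    ring
  | @cond p c d hc hd ihc ihd =>
    have h1 := ihc hM hs y
    have h2 := ihd hM hs y
    simp only [run, growth, add_mul]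
    split_ifs <;> omega

/-- The time bound does not depend on the register contents, and the values grow at most by a
constant factor. In a sequence, `growth c * M` becomes the register bound for the second program. -/
theorem exists_exec_run {B M : ℕ} {c : Prog} (hc : Straight c) {s : ℕ → ℕ} (hM : 1 ≤ M)
    (hs : ∀ x, s x ≤ M) (hB : growth c * M ≤ B) :
    ∃ T ≤ maxCost c, Exec B c s (run c s) [] T := by
  induction hc generalizing s M with
  | assign x a =>
    refine ⟨_, le_rfl, .assign (a.fits hM hs (le_trans ?_ hB))⟩
    exact Nat.mul_le_mul_right _ (Nat.le_succ _)
  | @seq c d hc hd ihc ihd =>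
    simp only [growth] at hB
    have h1 : 1 ≤ growth c * M := Nat.mul_pos (one_le_growth hc) hM
    have h2 : growth c * M ≤ B := le_trans
      (by rw [mul_right_comm]; exact Nat.le_mul_of_pos_right _ (one_le_growth hd)) hB
    obtain ⟨T, hT, h⟩ := ihc hM hs h2
    obtain ⟨U, hU, h'⟩ := ihd h1 (run_le hc hM hs) (le_of_eq_of_le (by ring) hB)
    exact ⟨T + U, Nat.add_le_add hT hU, .seq h h'⟩
  | @cond p c d hc hd ihc ihd =>
    simp only [growth, add_mul] at hB
    have hp := p.fits hM hs (B := B) (by omega)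
    by_cases h : p.Holds s
    · obtain ⟨T, hT, h'⟩ := ihc hM hs (by omega)
      refine ⟨p.cost + 1 + T, by simp only [maxCost]; omega, ?_⟩
      simp only [run, if_pos h]
      exact .condTrue hp h h'
    · obtain ⟨T, hT, h'⟩ := ihd hM hs (by omega)
      refine ⟨p.cost + 1 + T, by simp only [maxCost]; omega, ?_⟩
      simp only [run, if_neg h]
      exact .condFalse hp h h'

/-! ### Division by a constant -/

/-- Division of register `x` by `d`: the remainder stays in `x`, the quotient is added to `q`. -/
def divProg (d x q : ℕ) : Prog :=
  .loop (.le (.const d) (.reg x))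
    (.seq (.assign x (.sub (.reg x) (.const d))) (.assign q (.add (.reg q) (.const 1))))

theorem exists_exec_divProg {B d x q : ℕ} (hd : 1 ≤ d) (hxq : x ≠ q) (hdB : d ≤ B) (N : ℕ)
    {s : ℕ → ℕ} (hN : s x ≤ N) (hsB : s q + s x ≤ B) :
    ∃ T ≤ 12 * (N + 1), Exec B (divProg d x q) s
      (Function.update (Function.update s x (s x % d)) q (s q + s x / d)) [] T := by
  induction N using Nat.strong_induction_on generalizing s with
  | _ N ih =>
    have hf : (BExp.le (.const d) (.reg x)).Fits B s := ⟨hdB, show s x ≤ B by omega⟩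
    by_cases h : d ≤ s x
    · have hs1 : (Function.update s x (s x - d)) q = s q := Function.update_of_ne hxq.symm _ _
      have h1 : Exec B (.assign x (.sub (.reg x) (.const d))) s
          (Function.update s x (s x - d)) [] 4 := .assign ⟨show s x ≤ B by omega, hdB⟩
      have h2 : Exec B (.assign q (.add (.reg q) (.const 1))) (Function.update s x (s x - d))
          (Function.update (Function.update s x (s x - d)) q
            ((Function.update s x (s x - d)) q + 1)) [] 4 := by
        refine .assign ⟨?_, ?_, ?_⟩ <;> simp only [AExp.Fits, AExp.eval, hs1] <;> omega
      rw [hs1] at h2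
      obtain ⟨T, hT, h3⟩ := ih (N - 1) (by omega)
        (s := Function.update (Function.update s x (s x - d)) q (s q + 1))
        (by simp [Function.update_of_ne hxq]; omega)
        (by simp [Function.update_of_ne hxq]; omega)
      -- One round costs 12: the test 3, the entry into the loop 1, and the two assignments 4 each.
      refine ⟨3 + 1 + (4 + 4) + T, by omega, ?_⟩
      have h4 : Exec B (divProg d x q) s _ [] (3 + 1 + (4 + 4) + T) := Exec.loopStep hf h (.seq h1 h2) h3
      convert h4 using 1
      funext y
      have e1 : (s x - d) % d = s x % d := (Nat.mod_eq_sub_mod h).symm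
      have e2 : s x / d = (s x - d) / d + 1 := Nat.div_eq_sub_div hd h
      rcases eq_or_ne y q with rfl | hy
      · simp [Function.update_of_ne hxq, e2]; omega
      · rcases eq_or_ne y x with rfl | hy'
        · simp [Function.update_of_ne hxq, e1]
        · simp [Function.update_of_ne hy, Function.update_of_ne hy']
    · refine ⟨4, by omega, ?_⟩
      have h4 : Exec B (divProg d x q) s s [] 4 := Exec.loopDone hf h
      convert h4 using 1
      have e1 : s x % d = s x := Nat.mod_eq_of_lt (by omega)
      have e2 : s x / d = 0 := Nat.div_eq_of_lt (by omega)
      simp [e1, e2]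

/-! ### The program

Registers: `0` and `1` hold `m` and `n`; `2`, `3`, `4`, `5`, `6`, `7` hold `n / 2`, `n % 2`,
`m / 2`, `m % 2`, `n / 2 % 2`, `n % 3`; `8` and `9` hold the current row and column, `10` the parity
of the column (for even `n`), and `11` is `1` until the algorithm terminates. -/

/-- The strict comparison. -/
def BExp.lt (a b : AExp) : BExp := .le (.add a (.const 1)) b

/-- Set the row. -/
def setRow (a : AExp) : Prog := .assign 8 a

/-- Signal termination. -/
def stopProg : Prog := .assign 11 (.const 0)

/-- Set the column and its parity. -/
def setCol (a b : AExp) : Prog := .seq (.assign 9 a) (.assign 10 b)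

/-- The next column for `n` odd. -/
def colOddProg : Prog :=
  .cond (.le (.reg 9) (.reg 2))
    (.assign 9 (.add (.add (.reg 9) (.reg 2)) (.const 1)))
    (.assign 9 (.sub (.reg 9) (.reg 2)))

/-- The next column for `n` even. -/
def colEvenProg : Prog :=
  .cond (.eq (.reg 6) (.const 0))
    (.cond (.le (.reg 9) (.reg 2))
      (.cond (.eq (.reg 10) (.const 1))
        (setCol (.add (.add (.reg 9) (.reg 2)) (.const 1)) (.sub (.const 1) (.reg 10)))
        (setCol (.sub (.add (.reg 9) (.reg 2)) (.const 1)) (.sub (.const 1) (.reg 10))))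
      (.cond (.not (.and (.not (.eq (.reg 9) (.add (.reg 2) (.const 1))))
          (.not (.eq (.reg 9) (.reg 1)))))
        (setCol (.sub (.reg 9) (.reg 2)) (.reg 10))
        (.cond (.eq (.reg 10) (.const 1))
          (setCol (.sub (.reg 9) (.add (.reg 2) (.const 1))) (.sub (.const 1) (.reg 10)))
          (setCol (.sub (.reg 9) (.sub (.reg 2) (.const 1))) (.sub (.const 1) (.reg 10))))))
    (.cond (.lt (.reg 9) (.reg 2))
      (.cond (.eq (.reg 10) (.const 1))
        (setCol (.add (.add (.reg 9) (.reg 2)) (.const 1)) (.reg 10))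
        (setCol (.sub (.add (.reg 9) (.reg 2)) (.const 1)) (.reg 10)))
      (.cond (.eq (.reg 9) (.reg 2))
        (setCol (.add (.reg 9) (.reg 2)) (.const 0))
        (.cond (.eq (.reg 9) (.add (.reg 2) (.const 1)))
          (setCol (.sub (.reg 9) (.reg 2)) (.const 1))
          (.cond (.eq (.reg 10) (.const 0))
            (setCol (.sub (.reg 9) (.add (.reg 2) (.const 1))) (.reg 10))
            (setCol (.sub (.reg 9) (.sub (.reg 2) (.const 1))) (.reg 10))))))

/-- The next column. -/
def colProg : Prog := .cond (.eq (.reg 3) (.const 1)) colOddProg colEvenProg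

/-- The next row for `m` even. -/
def rowEvenProg : Prog :=
  .cond (.eq (.reg 3) (.const 1))
    (.cond (.le (.reg 8) (.reg 4)) (setRow (.add (.reg 8) (.reg 4)))
      (.cond (.not (.eq (.reg 9) (.const 1))) (setRow (.sub (.reg 8) (.reg 4)))
        (.cond (.lt (.reg 8) (.reg 0)) (setRow (.sub (.reg 8) (.sub (.reg 4) (.const 1))))
          stopProg)))
    (.cond (.not (.eq (.reg 9) (.const 1)))
      (.cond (.le (.reg 8) (.reg 4)) (setRow (.add (.reg 8) (.reg 4)))
        (setRow (.sub (.reg 8) (.reg 4))))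
      (.cond (.lt (.reg 8) (.reg 4)) (setRow (.add (.reg 8) (.add (.reg 4) (.const 1))))
        (.cond (.eq (.reg 8) (.reg 4)) stopProg
          (setRow (.sub (.reg 8) (.sub (.reg 4) (.const 1)))))))

/-- The next row for `m = 3`. -/
def rowThreeProg : Prog :=
  .cond (.not (.eq (.reg 9) (.const 1)))
    (.cond (.eq (.reg 8) (.const 3)) (setRow (.const 1)) (setRow (.add (.reg 8) (.const 1))))
    (.cond (.not (.eq (.reg 7) (.const 0)))
      (.cond (.eq (.reg 8) (.const 3)) stopProg (setRow (.add (.reg 8) (.const 1))))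
      (.cond (.eq (.reg 8) (.const 1)) (setRow (.const 3))
        (.cond (.eq (.reg 8) (.const 3)) (setRow (.const 2)) stopProg)))

/-- The next row for `m ≥ 5` odd and `n` not divisible by three. -/
def rowOddProg : Prog :=
  .cond (.eq (.reg 3) (.const 1))
    (.cond (.le (.reg 8) (.add (.reg 4) (.const 1))) (setRow (.add (.reg 8) (.reg 4)))
      (.cond (.not (.eq (.reg 9) (.const 1)))
        (.cond (.lt (.reg 8) (.reg 0)) (setRow (.sub (.reg 8) (.reg 4))) (setRow (.const 1)))
        (.cond (.lt (.reg 8) (.sub (.reg 0) (.const 1)))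
          (setRow (.sub (.reg 8) (.sub (.reg 4) (.const 1))))
          (.cond (.eq (.reg 8) (.sub (.reg 0) (.const 1))) stopProg (setRow (.const 2))))))
    (.cond (.not (.eq (.reg 9) (.const 1)))
      (.cond (.le (.reg 8) (.add (.reg 4) (.const 1))) (setRow (.add (.reg 8) (.reg 4)))
        (.cond (.lt (.reg 8) (.reg 0)) (setRow (.sub (.reg 8) (.reg 4))) (setRow (.const 1))))
      (.cond (.not (.and (.not (.eq (.reg 8) (.const 1)))
          (.not (.eq (.reg 8) (.add (.reg 4) (.const 1))))))
        (setRow (.add (.reg 8) (.reg 4)))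
        (.cond (.lt (.reg 8) (.reg 4)) (setRow (.add (.reg 8) (.add (.reg 4) (.const 1))))
          (.cond (.eq (.reg 8) (.reg 4)) stopProg
            (.cond (.lt (.reg 8) (.sub (.reg 0) (.const 1)))
              (setRow (.sub (.reg 8) (.sub (.reg 4) (.const 1))))
              (.cond (.eq (.reg 8) (.sub (.reg 0) (.const 1)))
                (setRow (.sub (.reg 8) (.sub (.reg 4) (.const 2)))) (setRow (.const 2))))))))

/-- The next row for `m ≥ 5` odd and `n` divisible by three. -/
def rowOddThreeProg : Prog :=
  .cond (.not (.eq (.reg 9) (.const 1)))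
    (.cond (.le (.reg 8) (.add (.reg 4) (.const 1))) (setRow (.add (.reg 8) (.reg 4)))
      (.cond (.lt (.reg 8) (.reg 0)) (setRow (.sub (.reg 8) (.reg 4))) (setRow (.const 1))))
    (.cond (.eq (.reg 8) (.const 1)) (setRow (.reg 0))
      (.cond (.eq (.reg 8) (.reg 0)) (setRow (.add (.reg 4) (.const 1)))
        (.cond (.eq (.reg 3) (.const 1))
          (.cond (.le (.reg 8) (.reg 4)) (setRow (.add (.reg 8) (.reg 4)))
            (.cond (.lt (.reg 8) (.sub (.reg 0) (.const 1)))
              (setRow (.sub (.reg 8) (.sub (.reg 4) (.const 1)))) stopProg))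
          (.cond (.lt (.reg 8) (.reg 4)) (setRow (.add (.reg 8) (.add (.reg 4) (.const 1))))
            (.cond (.eq (.reg 8) (.reg 4)) stopProg
              (.cond (.lt (.reg 8) (.sub (.reg 0) (.const 1)))
                (setRow (.sub (.reg 8) (.sub (.reg 4) (.const 1))))
                (setRow (.sub (.reg 8) (.sub (.reg 4) (.const 2))))))))))

/-- The next row, or termination. -/
def rowProg : Prog :=
  .cond (.eq (.reg 0) (.const 1))
    (.cond (.eq (.reg 9) (.const 1)) stopProg (setRow (.const 1)))
    (.cond (.eq (.reg 5) (.const 0)) rowEvenProg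
      (.cond (.eq (.reg 0) (.const 3)) rowThreeProg
        (.cond (.not (.eq (.reg 7) (.const 0))) rowOddProg rowOddThreeProg)))

/-- One step of the algorithm, without the output. -/
def stepProg : Prog := .seq rowProg colProg

/-- The initialization of the current node. -/
def startProg : Prog :=
  .seq (.assign 8 (.const 1)) (.seq (.assign 9 (.const 1)) (.seq (.assign 10 (.const 1))
    (.seq (.assign 11 (.const 1)) colProg)))

/-- Remainder and quotient of register `y` by `d`, in registers `x` and `q`. -/
def splitProg (d y x q : ℕ) : Prog := .seq (.assign x (.reg y)) (divProg d x q)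

/-- The main loop. -/
def mainLoop : Prog :=
  .loop (.eq (.reg 11) (.const 1)) (.seq (.emit (.reg 8) (.reg 9)) stepProg)

/-- The program for `Weave`. -/
def weaveProg : Prog :=
  .seq (splitProg 2 1 3 2) (.seq (splitProg 2 0 5 4) (.seq (splitProg 2 2 6 12)
    (.seq (splitProg 3 1 7 13) (.seq startProg mainLoop))))

/-! ### Correctness and running time of the program -/

theorem straight_setRow (a : AExp) : Straight (setRow a) := .assign _ _

theorem straight_stopProg : Straight stopProg := .assign _ _

theorem straight_setCol (a b : AExp) : Straight (setCol a b) := .seq (.assign _ _) (.assign _ _)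

theorem straight_colProg : Straight colProg := by
  unfold colProg colOddProg colEvenProg
  repeat' first
    | exact straight_setCol _ _
    | exact .assign _ _
    | refine .cond ?_ ?_

theorem straight_rowProg : Straight rowProg := by
  unfold rowProg rowEvenProg rowThreeProg rowOddProg rowOddThreeProg
  repeat' first
    | exact straight_setRow _
    | exact straight_stopProg
    | refine .cond ?_ ?_

theorem straight_stepProg : Straight stepProg := .seq straight_rowProg straight_colProg

theorem straight_startProg : Straight startProg :=
  .seq (.assign _ _) (.seq (.assign _ _) (.seq (.assign _ _)
    (.seq (.assign _ _) straight_colProg)))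

/-- The invariant of the main loop. -/
structure Invariant (m n i j : ℕ) (s : ℕ → ℕ) : Prop where
  reg0 : s 0 = m
  reg1 : s 1 = n
  reg2 : s 2 = n / 2
  reg3 : s 3 = n % 2
  reg4 : s 4 = m / 2
  reg5 : s 5 = m % 2
  reg6 : s 6 = n / 2 % 2
  reg7 : s 7 = n % 3
  reg8 : s 8 = i
  reg9 : s 9 = j
  reg10 : n % 2 = 0 → s 10 = j % 2
  le : ∀ x, s x ≤ n

/-- The programs nest their case distinctions exactly as the specification does, so both trees can
be descended together, branch by branch. -/
theorem run_cond_eq {α : Type*} {F : α → ℕ → ℕ} {p : BExp} {c d : Prog} {s : ℕ → ℕ} {q : Prop}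
    [Decidable q] {a b : α} (hpq : p.Holds s ↔ q) (h1 : q → run c s = F a)
    (h2 : ¬ q → run d s = F b) : run (.cond p c d) s = F (if q then a else b) := by
  by_cases hq : q
  · simp only [run, hpq, if_pos hq, h1 hq]
  · simp only [run, hpq, if_neg hq, h2 hq]

/-- The registers after the new row has been stored, or termination has been signalled. -/
def rowUpdate (s : ℕ → ℕ) : Option ℕ → ℕ → ℕ
  | none => Function.update s 11 0
  | some i => Function.update s 8 i

theorem run_rowProg {m n i j : ℕ} {s : ℕ → ℕ} (h : Invariant m n i j s) :
    run rowProg s = rowUpdate s (nextRow m n i j) := by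
  obtain ⟨h0, -, -, h3, h4, h5, -, h7, h8, h9, -, -⟩ := h
  unfold rowProg rowEvenProg rowThreeProg rowOddProg rowOddThreeProg
  unfold nextRow nextRowEven nextRowThree nextRowOdd nextRowOddThree
  repeat' first
    | (refine run_cond_eq ?_ (fun _ => ?_) (fun _ => ?_)
       · simp only [BExp.Holds, BExp.lt, AExp.eval, h0, h3, h4, h5, h7, h8, h9] <;> omega)
    | simp only [setRow, stopProg, run, AExp.eval, h0, h4, h8, rowUpdate]

/-- The registers after the new column has been stored. -/
def colUpdate (s : ℕ → ℕ) (j : ℕ) : ℕ → ℕ :=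
  Function.update (Function.update s 9 j) 10 (j % 2)

theorem run_colOddProg {n j : ℕ} {s : ℕ → ℕ} (hn : n % 2 = 1) (h2 : s 2 = n / 2) (h9 : s 9 = j) :
    run colOddProg s = Function.update s 9 (nextCol n j) := by
  unfold colOddProg nextCol
  simp only [hn, if_true]
  refine run_cond_eq (F := fun v => Function.update s 9 v) ?_ (fun _ => ?_) (fun _ => ?_) <;>
    simp only [BExp.Holds, run, AExp.eval, h2, h9]

theorem run_setCol {s : ℕ → ℕ} {a b : AExp} {j : ℕ} (ha : a.eval s = j)
    (hb : b.eval (Function.update s 9 j) = j % 2) : run (setCol a b) s = colUpdate s j := by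
  simp only [setCol, run, ha, hb, colUpdate]

/-- There is no division in the language, so the parity of the column is carried along: shifts by `k
± 1` flip it for even `k` and keep it for odd `k`. -/
theorem run_colEvenProg {n j : ℕ} {s : ℕ → ℕ} (hn : n % 2 = 0) (hj : 1 ≤ j) (hjn : j ≤ n)
    (h1 : s 1 = n) (h2 : s 2 = n / 2) (h6 : s 6 = n / 2 % 2) (h9 : s 9 = j) (h10 : s 10 = j % 2) :
    run colEvenProg s = colUpdate s (nextCol n j) := by
  unfold colEvenProg nextCol
  simp only [hn, zero_ne_one, if_false]
  repeat' first
    | (refine run_cond_eq (F := colUpdate s) ?_ (fun _ => ?_) (fun _ => ?_)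
       · simp only [BExp.Holds, BExp.lt, AExp.eval, h1, h2, h6, h9, h10] <;> omega)
    | (refine run_setCol ?_ ?_ <;>
        simp only [AExp.eval, h2, h9, h10,
          Function.update_of_ne (by decide : (10 : ℕ) ≠ 9)] <;> omega)

theorem invariant_run_colProg {m n i j : ℕ} {s : ℕ → ℕ} (hj : 1 ≤ j) (hjn : j ≤ n)
    (h : Invariant m n i j s) :
    Invariant m n i (nextCol n j) (run colProg s) ∧ run colProg s 11 = s 11 := by
  have hle : nextCol n j ≤ n := by
    simp only [nextCol]
    split_ifs <;> omega
  obtain ⟨h0, h1, h2, h3, h4, h5, h6, h7, h8, h9, h10, hs⟩ := h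
  rcases Nat.mod_two_eq_zero_or_one n with hn | hn
  · have hr : run colProg s = colUpdate s (nextCol n j) := by
      rw [← run_colEvenProg hn hj hjn h1 h2 h6 h9 (h10 hn)]
      simp [colProg, run, BExp.Holds, AExp.eval, h3, hn]
    rw [hr]
    refine ⟨⟨h0, h1, h2, h3, h4, h5, h6, h7, h8, rfl, fun _ => rfl, fun x => ?_⟩, rfl⟩
    have hx := hs x
    simp only [colUpdate, Function.update_apply]
    split_ifs <;> omega
  · have hr : run colProg s = Function.update s 9 (nextCol n j) := by
      rw [← run_colOddProg hn h2 h9]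
      simp [colProg, run, BExp.Holds, AExp.eval, h3, hn]
    rw [hr]
    refine ⟨⟨h0, h1, h2, h3, h4, h5, h6, h7, h8, rfl, fun h => by omega, fun x => ?_⟩, rfl⟩
    have hx := hs x
    simp only [Function.update_apply]
    split_ifs <;> omega

theorem invariant_rowUpdate_some {m n i j i' : ℕ} {s : ℕ → ℕ} (hi' : i' ≤ n)
    (h : Invariant m n i j s) : Invariant m n i' j (rowUpdate s (some i')) := by
  obtain ⟨h0, h1, h2, h3, h4, h5, h6, h7, h8, h9, h10, hs⟩ := h
  refine ⟨h0, h1, h2, h3, h4, h5, h6, h7, rfl, h9, h10, fun x => ?_⟩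
  have hx := hs x
  simp only [rowUpdate, Function.update_apply]
  split_ifs <;> omega

theorem invariant_rowUpdate_none {m n i j : ℕ} {s : ℕ → ℕ} (h : Invariant m n i j s) :
    Invariant m n i j (rowUpdate s none) := by
  obtain ⟨h0, h1, h2, h3, h4, h5, h6, h7, h8, h9, h10, hs⟩ := h
  refine ⟨h0, h1, h2, h3, h4, h5, h6, h7, h8, h9, h10, fun x => ?_⟩
  have hx := hs x
  simp only [rowUpdate, Function.update_apply]
  split_ifs <;> omega

theorem exists_exec_mainLoop {B m n i j : ℕ} {L : List (ℕ × ℕ)} (hmn : m ≤ n)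
    (hw : WeaveFrom m n i j L)
    (hL : ∀ p ∈ L, (1 ≤ p.1 ∧ p.1 ≤ m) ∧ (1 ≤ p.2 ∧ p.2 ≤ n)) (hB : growth stepProg * n ≤ B)
    {s : ℕ → ℕ} (h : Invariant m n i j s) (h11 : s 11 = 1) :
    ∃ s', ∃ T ≤ (maxCost stepProg + 7) * L.length + 4, Exec B mainLoop s s' L T := by
  have hnB : n ≤ B :=
    (Nat.le_mul_of_pos_left n (one_le_growth straight_stepProg)).trans hB
  induction hw generalizing s with
  | @last i j hnone =>
    have hp := hL _ List.mem_cons_self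
    simp only at hp
    have hfit : (BExp.eq (.reg 11) (.const 1)).Fits B s :=
      ⟨(h.le 11).trans hnB, show 1 ≤ B by omega⟩
    obtain ⟨T, hT, he⟩ := exists_exec_run straight_stepProg (by omega) h.le hB
    have hem : Exec B (.emit (.reg 8) (.reg 9)) s s [(s 8, s 9)] 3 :=
      .emit ((h.le 8).trans hnB) ((h.le 9).trans hnB)
    rw [h.reg8, h.reg9] at hem
    have hrun : run stepProg s = run colProg (rowUpdate s none) := by
      rw [← hnone, ← run_rowProg h]
      rfl
    -- The column still moves after termination has been signalled, but this leaves the flag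
    -- untouched and nothing more is output.
    obtain ⟨hinv, h11'⟩ := invariant_run_colProg hp.2.1 hp.2.2 (invariant_rowUpdate_none h)
    rw [hrun] at he
    have h_flag : run colProg (rowUpdate s none) 11 = 0 := h11'
    have hdone : Exec B mainLoop (run colProg (rowUpdate s none)) _ [] 4 :=
      .loopDone ⟨(hinv.le 11).trans hnB, show 1 ≤ B by omega⟩
        (by simp [BExp.Holds, AExp.eval, h_flag])
    refine ⟨_, _, ?_, .loopStep hfit h11 (.seq hem he) hdone⟩
    simp only [BExp.cost, AExp.cost, List.length_singleton]
    omega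
  | @step i j i' L hsome hw ih =>
    have hp := hL _ List.mem_cons_self
    simp only at hp
    have hL' : ∀ p ∈ L, (1 ≤ p.1 ∧ p.1 ≤ m) ∧ (1 ≤ p.2 ∧ p.2 ≤ n) :=
      fun p hp => hL p (List.mem_cons_of_mem _ hp)
    have hi' : i' ≤ n := by
      have : (i', nextCol n j) ∈ L := by
        cases hw <;> exact List.mem_cons_self
      exact (hL' _ this).1.2.trans hmn
    have hfit : (BExp.eq (.reg 11) (.const 1)).Fits B s :=
      ⟨(h.le 11).trans hnB, show 1 ≤ B by omega⟩
    obtain ⟨T, hT, he⟩ := exists_exec_run straight_stepProg (by omega) h.le hB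
    have hem : Exec B (.emit (.reg 8) (.reg 9)) s s [(s 8, s 9)] 3 :=
      .emit ((h.le 8).trans hnB) ((h.le 9).trans hnB)
    rw [h.reg8, h.reg9] at hem
    have hrun : run stepProg s = run colProg (rowUpdate s (some i')) := by
      rw [← hsome, ← run_rowProg h]
      rfl
    obtain ⟨hinv, h11'⟩ := invariant_run_colProg hp.2.1 hp.2.2 (invariant_rowUpdate_some hi' h)
    rw [hrun] at he
    obtain ⟨s', U, hU, hrest⟩ := ih hL' hinv (h11'.trans h11)
    refine ⟨s', _, ?_, .loopStep hfit h11 (.seq hem he) hrest⟩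
    simp only [BExp.cost, AExp.cost, List.length_cons, mul_add]
    omega

theorem exists_exec_splitProg {B d y x q N : ℕ} (hd : 1 ≤ d) (hxq : x ≠ q) (hdB : d ≤ B)
    (hNB : N ≤ B) {s : ℕ → ℕ} (hN : s y ≤ N) (hq : s q = 0) :
    ∃ T ≤ 12 * (N + 1) + 2, Exec B (splitProg d y x q) s
      (Function.update (Function.update s x (s y % d)) q (s y / d)) [] T := by
  have h1 : Exec B (.assign x (.reg y)) s (Function.update s x (s y)) [] 2 :=
    .assign (show s y ≤ B by omega)
  have hq' : Function.update s x (s y) q = 0 := by rw [Function.update_of_ne hxq.symm, hq]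
  obtain ⟨T, hT, h2⟩ := exists_exec_divProg (B := B) hd hxq hdB N
    (s := Function.update s x (s y)) (by simpa using hN)
    (by rw [hq', Function.update_self]; omega)
  refine ⟨2 + T, by omega, ?_⟩
  have h3 : Exec B (splitProg d y x q) s _ _ _ := Exec.seq h1 h2
  simpa [hq'] using h3

theorem exists_outputsWithin_weaveProg : ∃ C, ∀ (m n : ℕ) (L : List (ℕ × ℕ)), 1 ≤ m → m ≤ n →
    IsWeave m n L → IsTour m n L → OutputsWithin weaveProg m n (C * (m * n)) L := by
  -- The 200 pays for the four divisions and for the test and output of each round; the `growth`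
  -- terms serve the word bound, the `maxCost` terms the running time.
  refine ⟨200 + growth stepProg + growth startProg + maxCost stepProg + maxCost startProg, ?_⟩
  intro m n L hm hmn hw hL
  set N := m * n with hN
  have hnN : n ≤ N := Nat.le_mul_of_pos_left n hm
  have hlen : L.length = N := hL.length_eq
  set B := (200 + growth stepProg + growth startProg + maxCost stepProg + maxCost startProg) * N
    with hB
  have hBsum : B = 200 * N + growth stepProg * N + growth startProg * N + maxCost stepProg * N +
      maxCost startProg * N := by rw [hB]; ring
  have hg1 : growth stepProg * n ≤ B := by
    have := Nat.mul_le_mul_left (growth stepProg) hnN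
    omega
  have hg2 : growth startProg * n ≤ B := by
    have := Nat.mul_le_mul_left (growth startProg) hnN
    omega
  have hc : maxCost startProg ≤ maxCost startProg * N := Nat.le_mul_of_pos_right _ (by omega)
  obtain ⟨T1, hT1, e1⟩ := exists_exec_splitProg (B := B) (d := 2) (y := 1) (x := 3) (q := 2)
    (N := n) (s := inputRegs m n) (by omega) (by omega) (by omega) (by omega) le_rfl rfl
  set s1 := Function.update (Function.update (inputRegs m n) 3 (inputRegs m n 1 % 2)) 2
    (inputRegs m n 1 / 2) with hs1
  obtain ⟨T2, hT2, e2⟩ := exists_exec_splitProg (B := B) (d := 2) (y := 0) (x := 5) (q := 4)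
    (N := n) (s := s1) (by omega) (by omega) (by omega) (by omega) hmn rfl
  set s2 := Function.update (Function.update s1 5 (s1 0 % 2)) 4 (s1 0 / 2) with hs2
  obtain ⟨T3, hT3, e3⟩ := exists_exec_splitProg (B := B) (d := 2) (y := 2) (x := 6) (q := 12)
    (N := n) (s := s2) (by omega) (by omega) (by omega) (by omega)
    (show n / 2 ≤ n by omega) rfl
  set s3 := Function.update (Function.update s2 6 (s2 2 % 2)) 12 (s2 2 / 2) with hs3
  obtain ⟨T4, hT4, e4⟩ := exists_exec_splitProg (B := B) (d := 3) (y := 1) (x := 7) (q := 13)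
    (N := n) (s := s3) (by omega) (by omega) (by omega) (by omega) le_rfl rfl
  set s4 := Function.update (Function.update s3 7 (s3 1 % 3)) 13 (s3 1 / 3) with hs4
  have hval : s1 0 = m ∧ s2 2 = n / 2 ∧ s3 1 = n := ⟨rfl, rfl, rfl⟩
  have hle : ∀ x, s4 x ≤ n := by
    intro x
    rw [hs4, hval.2.2, hs3, hval.2.1, hs2, hval.1, hs1]
    simp only [Function.update_apply, inputRegs]
    have h3 : n % 3 ≤ n := Nat.mod_le _ _
    have h2 : n % 2 ≤ n := Nat.mod_le _ _
    have h6 : n / 2 % 2 ≤ n := by omega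
    split_ifs
    all_goals try omega
    split <;> omega
  obtain ⟨T5, hT5, e5⟩ := exists_exec_run straight_startProg (by omega) hle hg2
  set s5 := Function.update (Function.update (Function.update (Function.update s4 8 1) 9 1) 10 1)
    11 1 with hs5
  -- The starting column is the successor of column 1, so one column move from the node `(1, 1)`
  -- produces the starting node.
  have hrun : run startProg s4 = run colProg s5 := rfl
  have hinv5 : Invariant m n 1 1 s5 := by
    refine ⟨rfl, rfl, rfl, rfl, rfl, rfl, rfl, rfl, rfl, rfl, fun _ => rfl, fun x => ?_⟩
    have := hle x
    simp only [hs5, Function.update_apply]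
    split_ifs <;> omega
  obtain ⟨hinv, h11⟩ := invariant_run_colProg le_rfl (hm.trans hmn) hinv5
  obtain ⟨s', T6, hT6, e6⟩ := exists_exec_mainLoop hmn hw (fun p hp => (hL.2 p).1 hp) hg1 hinv h11
  rw [hrun] at e5
  refine ⟨s', _, ?_, .seq e1 (.seq e2 (.seq e3 (.seq e4 (.seq e5 e6))))⟩
  rw [hlen, add_mul] at hT6
  omega

end ScatterTSP

theorem theorem1 :
    ∃ (P : Prog) (C : ℕ), ∀ m n k t : ℕ, 1 ≤ m → m ≤ n → k = n / 2 → t = m / 2 →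
      ∃ L : List (ℕ × ℕ),
        IsWeave m n L ∧
        OutputsWithin P m n (C * (m * n)) L ∧
        IsTour m n L ∧
        ((Odd n ∨ m = n ∨ m = 2) → IsOptimal m n L) ∧
        (Even m → Even n →
          IsApprox (√(1 - 2 * ((k : ℝ) - t) / (((k : ℝ) - t) ^ 2 + 2 * t * ((k : ℝ) - 1) + 1)))
            m n L) ∧
        (Odd m → Even n →
          IsApprox (√(1 - (2 * (k : ℝ) - 1) / ((k : ℝ) ^ 2 + (t : ℝ) ^ 2))) m n L) := by
  obtain ⟨C, hC⟩ := exists_outputsWithin_weaveProg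
  refine ⟨weaveProg, C, fun m n k t hm hmn hk ht => ?_⟩
  have hw := isWeave_weaveList hm (hm.trans hmn)
  have hL := isTour_weaveList m n
  have hlow := hw.le_shortestEdge hmn hL
  refine ⟨weaveList m n, hw, hC m n _ hm hmn hw hL, hL, isOptimal_of_isWeave hm hmn hw hL, ?_, ?_⟩
  · intro hme hne
    have hm2 := Nat.even_iff.1 hme
    have hn2 := Nat.even_iff.1 hne
    have hk1 : (1 : ℝ) ≤ k := by exact_mod_cast (by omega : 1 ≤ k)
    rw [show (n - 1) / 2 = k - 1 by omega, Nat.cast_sub (by omega), ← ht, Nat.cast_one] at hlow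
    have hup := fun T (hT : IsTour m n T) => hT.shortestEdge_le_of_even hm hmn hme hne
    rw [← hk, ← ht] at hup
    -- The denominator is the squared upper bound, and the numerator `2 (k - t)` is its excess over
    -- the squared lower bound `(k - 1)² + t²`.
    have hb : ((k : ℝ) - t) ^ 2 + 2 * t * ((k : ℝ) - 1) + 1 = (k : ℝ) ^ 2 + ((t : ℝ) - 1) ^ 2 := by
      ring
    rw [hb]
    refine isApprox_of_sqrt hL (by positivity) (le_of_eq_of_le ?_ hlow) hup
    congr 1
    ring
  · intro hmo hne
    have hn2 := Nat.even_iff.1 hne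
    have hk1 : (1 : ℝ) ≤ k := by exact_mod_cast (by omega : 1 ≤ k)
    rw [show (n - 1) / 2 = k - 1 by omega, Nat.cast_sub (by omega), ← ht, Nat.cast_one] at hlow
    have hup := fun T (hT : IsTour m n T) => hT.shortestEdge_le hm (hm.trans hmn)
    rw [← hk, ← ht] at hup
    refine isApprox_of_sqrt hL (by positivity) (le_of_eq_of_le ?_ hlow) hup
    congr 1
    ring
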